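/- Fix $d\ge 1$, radii $0<r_n<1/4$ and integers $k_n\ge 2$ ($n\in\mathbb N$). Let $N_n$ be Poisson with mean $n$, and let $X_1,X_2,\dots$ be i.i.d. uniform on $[0,1]^d$, independent of $N_n$. The graph $G(n,r_n)$ has vertex set $V=\{1,\dots,N_n\}$, and distinct $i,j$ are adjacent iff $d_T(X_i,X_j)\le r_n$, where $d_T(x,y)=\bigl(\sum_{l=1}^d \min(|x_l-y_l|,1-|x_l-y_l|)^2\bigr)^{1/2}$. The graph $G_{k_n}(n,r_n)$ is obtained by choosing, independently of the positions, a uniformly random set $K_n$ of $k_n$ vertices (all vertices, if $N_n<k_n$) and adding all missing edges between vertices of $K_n$. The vertex-degree algorithm outputs a set of $k_n$ vertices with the largest degrees in $G_{k_n}(n,r_n)$ (all vertices, if $N_n<k_n$). Let $\mu_n=n\phi_d r_n^d$, where $\phi_d$ is the volume of the $d$-dimensional Euclidean unit ball, let $H(x)=1-x+x\log x$, and let $H_+^{-1}:[0,\infty)\to[1,\infty)$ be the inverse of the restriction of $H$ to $[1,\infty)$. Suppose that either (i) $\lim_{n\to\infty}\mu_n/\log n=\alpha\in(0,\infty)$ and,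 for some fixed $\varepsilon\in(0,1)$, $k_n\le(1-\varepsilon)(T(n)-\mu_n)$ for all large $n$, where $T(n)=\mu_n H_+^{-1}(1/\alpha)$; or (ii) $\lim_{n\to\infty}\mu_n/\log n=\infty$, $\mu_n=o(n)$ and $k_n=o(\sqrt{\mu_n})$. Then the vertex-degree algorithm fails to recover $K_n$ asymptotically almost surely, however it breaks ties: the probability that $K_n$ is not a possible output of the algorithm (that is, that no way of breaking ties makes the output equal to $K_n$) tends to $1$ as $n\to\infty$. -/

import Mathlib

open MeasureTheory ProbabilityTheory Filter Topology Asymptotics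

noncomputable section

/-- The unit cube `[0,1]^d`. Its canonical measure `volume` is the uniform distribution. -/
abbrev Cube (d : ℕ) : Type := Fin d → unitInterval

/-- The toroidal Euclidean distance on the unit cube. -/
def torusDist {d : ℕ} (x y : Cube d) : ℝ :=
  √(∑ i, (min |(x i : ℝ) - y i| (1 - |(x i : ℝ) - y i|)) ^ 2)

theorem torusDist_comm {d : ℕ} (x y : Cube d) : torusDist x y = torusDist y x := by
  simp only [torusDist, abs_sub_comm]

/-- The hard geometric graph of radius `r` on points `x 0, …, x (N - 1)` of the torus. -/
def geometricGraph {d N : ℕ} (r : ℝ) (x : Fin N → Cube d) : SimpleGraph (Fin N) where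
  Adj i j := i ≠ j ∧ torusDist (x i) (x j) ≤ r
  symm := ⟨fun i j h => ⟨h.1.symm, torusDist_comm (x i) (x j) ▸ h.2⟩⟩
  loopless := ⟨fun _ h => h.1 rfl⟩

/-- The graph obtained from `G` by adding all missing edges between vertices of `K`. -/
def plantClique {V : Type*} (G : SimpleGraph V) (K : Finset V) : SimpleGraph V where
  Adj i j := G.Adj i j ∨ (i ≠ j ∧ i ∈ K ∧ j ∈ K)
  symm := ⟨fun _ _ h => h.imp (fun h => h.symm) fun h => ⟨h.1.symm, h.2.2, h.2.1⟩⟩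
  loopless := ⟨fun i h => h.elim (G.irrefl (v := i)) fun h => h.1 rfl⟩

open Classical in
/-- All possible outputs of the vertex-degree algorithm with input `(G, k)`: the sets of `k`
vertices with largest degrees. There is one output for each way of breaking ties between vertices
of equal degree. (If `G` has fewer than `k` vertices, then all of them are returned.) -/
def vdOutputs {V : Type*} [Fintype V] (G : SimpleGraph V) (k : ℕ) : Set (Finset V) :=
  {S | S.card = min k (Fintype.card V) ∧ ∀ i ∈ S, ∀ j ∉ S, G.degree j ≤ G.degree i}

/-- Outcomes: a number of vertices `N`, the positions `X 0, X 1, …`, and a set `K` of (labels of)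
clique vertices. The vertex set of the graph is `{0, …, N - 1}`. -/
abbrev Outcome (d : ℕ) : Type := ℕ × (ℕ → Cube d) × Finset ℕ

theorem cliqueChoices_nonempty (k N : ℕ) :
    (Finset.powersetCard (min k N) (Finset.range N)).Nonempty :=
  Finset.powersetCard_nonempty.2 (by simp)

/-- The uniform distribution on the subsets of size `k` of `{0, …, N - 1}` (on the one-point set
`{{0, …, N - 1}}` if `N < k`). -/
def cliqueLaw (k N : ℕ) : Measure (Finset ℕ) :=
  (PMF.uniformOfFinset (Finset.powersetCard (min k N) (Finset.range N))
    (cliqueChoices_nonempty k N)).toMeasure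

instance (k N : ℕ) : IsProbabilityMeasure (cliqueLaw k N) := by
  unfold cliqueLaw; infer_instance

/-- The conditional distribution of positions and clique given the number of vertices: the positions
are independent and uniform on the cube, and the clique is uniform and independent of them. -/
def positionsCliqueKernel (d k : ℕ) : Kernel ℕ ((ℕ → Cube d) × Finset ℕ) :=
  Kernel.ofFunOfCountable fun N =>
    (Measure.infinitePi fun _ : ℕ => (volume : Measure (Cube d))).prod (cliqueLaw k N)

instance (d k : ℕ) : IsMarkovKernel (positionsCliqueKernel d k) :=
  ⟨fun N => by
    change IsProbabilityMeasure
      ((Measure.infinitePi fun _ : ℕ => (volume : Measure (Cube d))).prod (cliqueLaw k N))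
    infer_instance⟩

/-- The joint law of the number of vertices (Poisson with mean `n`), positions and clique. -/
def plantedLaw (d n k : ℕ) : Measure (Outcome d) :=
  (poissonMeasure (n : NNReal)) ⊗ₘ (positionsCliqueKernel d k)

instance (d n k : ℕ) : IsProbabilityMeasure (plantedLaw d n k) := by
  unfold plantedLaw; infer_instance

/-- The planted clique, as a set of vertices of the random graph. -/
def plantedSet {d : ℕ} (ω : Outcome d) : Finset (Fin ω.1) :=
  Finset.univ.filter fun i => (i : ℕ) ∈ ω.2.2

/-- The random geometric graph of radius `r` with the planted clique. -/
def plantedGraph {d : ℕ} (r : ℝ) (ω : Outcome d) : SimpleGraph (Fin ω.1) :=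
  plantClique (geometricGraph r fun i => ω.2.1 i) (plantedSet ω)

/-- The event that the vertex-degree algorithm fails to recover the planted clique, whichever way
it breaks ties. -/
def vdFails (d : ℕ) (r : ℝ) (k : ℕ) : Set (Outcome d) :=
  {ω | plantedSet ω ∉ vdOutputs (plantedGraph r ω) k}

/-- The average degree `μ = n φ_d r^d`, with `φ_d` the volume of the Euclidean unit ball. -/
def meanDegree (d n : ℕ) (r : ℝ) : ℝ :=
  n * volume.real (Metric.ball (0 : EuclideanSpace ℝ (Fin d)) 1) * r ^ d

/-- The entropy function `H(x) = 1 - x + x log x`. -/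
def entropyH (x : ℝ) : ℝ := 1 - x + x * Real.log x

/-- The upper branch of the inverse of `H`, with values in `[1, ∞)`. -/
def entropyInv (y : ℝ) : ℝ := Function.invFunOn entropyH (Set.Ici 1) y

/-- `entropyInv` is well defined: `H` maps `[1, ∞)` bijectively onto `[0, ∞)`. -/
theorem entropyH_bijOn : Set.BijOn entropyH (Set.Ici 1) (Set.Ici 0) := by
  have hc : Continuous entropyH := by
    unfold entropyH
    exact (continuous_const.sub continuous_id).add Real.continuous_mul_log
  have hm : StrictMonoOn entropyH (Set.Ici 1) := by
    apply strictMonoOn_of_deriv_pos (convex_Ici 1) hc.continuousOn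
    intro x hx
    rw [interior_Ici, Set.mem_Ioi] at hx
    have hd : HasDerivAt entropyH (0 - 1 + (Real.log x + 1)) x :=
      ((hasDerivAt_const x 1).sub (hasDerivAt_id x)).add (Real.hasDerivAt_mul_log (by linarith))
    rw [hd.deriv]
    linarith [Real.log_pos hx]
  have h1 : entropyH 1 = 0 := by simp [entropyH]
  refine ⟨fun x hx => ?_, hm.injOn, fun y hy => ?_⟩
  · rw [Set.mem_Ici, ← h1]
    exact hm.monotoneOn Set.self_mem_Ici hx hx
  · have hb : y ≤ entropyH (Real.exp (2 + y)) := by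
      have he := Real.add_one_le_exp (2 + y)
      rw [Set.mem_Ici] at hy
      simp only [entropyH, Real.log_exp]
      nlinarith
    have h2 : (1 : ℝ) ≤ Real.exp (2 + y) := Real.one_le_exp (by rw [Set.mem_Ici] at hy; linarith)
    obtain ⟨x, hx, rfl⟩ := intermediate_value_Icc h2 hc.continuousOn ⟨h1 ▸ hy, hb⟩
    exact ⟨x, hx.1, rfl⟩

theorem entropyInv_spec {y : ℝ} (hy : 0 ≤ y) :
    1 ≤ entropyInv y ∧ entropyH (entropyInv y) = y :=
  ⟨Function.invFunOn_mem (entropyH_bijOn.surjOn hy), Function.invFunOn_eq (entropyH_bijOn.surjOn hy)⟩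

/-- The asymptotic maximal degree `T = μ H₊⁻¹(1/α)` in the regime `μ / log n → α ∈ (0, ∞)`. -/
def maxDegreeScale (μ α : ℝ) : ℝ := μ * entropyInv α⁻¹

end

/-! Recovery fails for every tie-breaking rule as soon as one vertex outside the clique has strictly
larger degree than one clique vertex. Write `v` for the volume of a ball of radius `r`, so that `μ =
n * v`, and fix a slack `L ≥ 1`. A fixed clique vertex has a binomial number of geometric
neighbours, at most `μ + 3L√μ` outside an event of probability `O(1/L²)` (Chebyshev, including the
Poisson fluctuation of `N`); planting adds at most `k`. It therefore suffices to find a vertex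
outside the clique with at least `t = μ + 3L√μ + k` neighbours. For this, about `n/μ` candidates are
put aside, and only their neighbours in a disjoint reservoir of fixed size are counted. Each
candidate then succeeds with the same binomial tail probability `p`. If two candidates are more than
`2r` apart, their balls are disjoint and the counts are negatively associated, so both succeed with
probability at most `p²`; they are closer with probability `2^d v`. The second moment method bounds
the probability that all candidates fail by `O(1/(p n/μ))` (`measureReal_degrees_bad_le`). Few
candidates are used so that removing them costs each ball only one expected point. What remains is
`p n/μ → ∞`, from a tail bound by exponential tilting (`le_binomialTail`). In regime (i), `t` lies
below `aμ` for some `a` with `α H(a) < 1`, and `p ≥ exp(-μ H(a) - O(√μ))` while `n = exp(log n)`. In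
regime (ii), `t ≤ μ + 4L√μ`, so `p` is bounded below in terms of `L` and `n/μ → ∞`. Finally `L` is
taken large. -/

/-! ### Expectations under the binomial distribution -/

/-- The expectation of `f` under the binomial distribution with parameters `n` and `p`. -/
noncomputable def binomialMean (p : ℝ) : ℕ → (ℕ → ℝ) → ℝ
  | 0, f => f 0
  | n + 1, f => p * binomialMean p n (fun s => f (s + 1)) + (1 - p) * binomialMean p n f

theorem binomialMean_mono {p : ℝ} (h0 : 0 ≤ p) (h1 : p ≤ 1) (n : ℕ) {f g : ℕ → ℝ}
    (hfg : ∀ s, f s ≤ g s) : binomialMean p n f ≤ binomialMean p n g := by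
  induction n generalizing f g with
  | zero => exact hfg 0
  | succ n ih =>
    have h2 : 0 ≤ 1 - p := by linarith
    simp only [binomialMean]
    gcongr
    · exact ih fun s => hfg (s + 1)
    · exact ih hfg

theorem binomialMean_const_mul (p c : ℝ) (n : ℕ) (f : ℕ → ℝ) :
    binomialMean p n (fun s => c * f s) = c * binomialMean p n f := by
  induction n generalizing f with
  | zero => rfl
  | succ n ih => simp only [binomialMean, ih]; ring

theorem binomialMean_sq (p c : ℝ) (n : ℕ) :
    binomialMean p n (fun s => ((s : ℝ) + c) ^ 2) = n * p * (1 - p) + (n * p + c) ^ 2 := by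
  induction n generalizing c with
  | zero => simp [binomialMean]
  | succ n ih =>
    have h : (fun s : ℕ => (((s + 1 : ℕ) : ℝ) + c) ^ 2) = fun s : ℕ => ((s : ℝ) + (1 + c)) ^ 2 := by
      ext s; push_cast; ring
    simp only [binomialMean, ih, h]
    push_cast
    ring

/-- Evaluates the quadratic minorant of an indicator used in `le_binomialTail`. The shift `c` is
kept general because the recursion replaces it by `1 + c`. -/
theorem binomialMean_one_sub_sq (p c a : ℝ) (n : ℕ) :
    binomialMean p n (fun s => 1 - a * ((s : ℝ) + c) ^ 2)
      = 1 - a * (n * p * (1 - p) + (n * p + c) ^ 2) := by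
  induction n generalizing c with
  | zero => simp [binomialMean]
  | succ n ih =>
    have h : (fun s : ℕ => 1 - a * (((s + 1 : ℕ) : ℝ) + c) ^ 2)
        = fun s : ℕ => 1 - a * ((s : ℝ) + (1 + c)) ^ 2 := by
      ext s; push_cast; ring
    simp only [binomialMean, ih, h]
    push_cast
    ring

/-- Exponential tilting. -/
theorem binomialMean_tilt {p q : ℝ} (hq : q ≠ 0) (hp1 : p ≠ 1) (hq1 : q ≠ 1) (n : ℕ)
    (f : ℕ → ℝ) :
    binomialMean p n f = ((1 - p) / (1 - q)) ^ n *
      binomialMean q n (fun s => ((p / q) * ((1 - q) / (1 - p))) ^ s * f s) := by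
  have h1 : 1 - p ≠ 0 := sub_ne_zero.2 hp1.symm
  have h2 : 1 - q ≠ 0 := sub_ne_zero.2 hq1.symm
  induction n generalizing f with
  | zero => simp [binomialMean]
  | succ n ih =>
    have h : (fun s : ℕ => ((p / q) * ((1 - q) / (1 - p))) ^ (s + 1) * f (s + 1))
        = fun s : ℕ => ((p / q) * ((1 - q) / (1 - p))) *
          (((p / q) * ((1 - q) / (1 - p))) ^ s * f (s + 1)) := by
      ext s; ring
    simp only [binomialMean, h, binomialMean_const_mul, ih f, ih fun s => f (s + 1)]
    rw [pow_succ ((1 - p) / (1 - q)) n]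
    generalize binomialMean q n _ = a
    generalize binomialMean q n _ = b
    generalize ((1 - p) / (1 - q)) ^ n = c
    field_simp

/-- The probability that a binomial random variable is at least `t`. -/
noncomputable def binomialTail (p : ℝ) (n : ℕ) (t : ℝ) : ℝ :=
  binomialMean p n (fun s => if t ≤ s then 1 else 0)

/-- Chebyshev's inequality for the upper tail of the binomial distribution. -/
theorem binomialTail_le {p : ℝ} (h0 : 0 ≤ p) (h1 : p ≤ 1) (n : ℕ) {t a : ℝ} (ha : 0 < a)
    (ht : n * p + a ≤ t) : binomialTail p n t ≤ n * p / a ^ 2 := by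
  have h : binomialTail p n t ≤
      binomialMean p n (fun s => (a ^ 2)⁻¹ * ((s : ℝ) + -(n * p)) ^ 2) := by
    refine binomialMean_mono h0 h1 n fun s => ?_
    split_ifs with hs
    · rw [← div_eq_inv_mul, one_le_div (by positivity)]
      have : a ≤ s + -(n * p) := by linarith
      gcongr
    · positivity
  rw [binomialMean_const_mul, binomialMean_sq] at h
  refine h.trans ?_
  rw [← div_eq_inv_mul]
  gcongr
  have : 0 ≤ n * p * p := by positivity
  linarith

/-- Lower bound for the upper tail of the binomial distribution, by tilting to a success
probability `q` with `n * q = m`. -/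
theorem le_binomialTail {p q : ℝ} (hp : 0 < p) (hpq : p ≤ q) (hq : q ≤ 1 / 2) {n : ℕ} {t : ℝ}
    {l m : ℝ} (hl : l = n * p) (hm : m = n * q) (hm0 : 0 < m) (ht : t ≤ m - 2 * √m)
    (hn : m + 2 * √m ≤ n) :
    3 / 4 * Real.exp (-(l * entropyH (m / l) + 2 * √m * Real.log (m / l)
      + 2 * (q - p) * (m - l + 2 * √m))) ≤ binomialTail p n t := by
  have hq0 : 0 < q := hp.trans_le hpq
  have hn0 : (0 : ℝ) < n := by
    have := Real.sqrt_nonneg m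
    linarith
  have hml : m / l = q / p := by rw [hm, hl, mul_div_mul_left _ _ hn0.ne']
  set x := q / p with hx
  set sg := (1 - p) / (1 - q) with hsg
  set u := m + 2 * √m with hu
  have hsg1 : 1 ≤ sg := by rw [hsg, le_div_iff₀ (by linarith)]; linarith
  have hx1 : 1 ≤ x := by rw [hx, le_div_iff₀ hp]; linarith
  have hth : p / q * ((1 - q) / (1 - p)) = Real.exp (-(Real.log x + Real.log sg)) := by
    rw [Real.exp_neg, Real.exp_add, Real.exp_log (by linarith), Real.exp_log (by linarith), hx, hsg]
    field_simp
  have hlx := Real.log_nonneg hx1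
  have hls := Real.log_nonneg hsg1
  -- Where `|s - m| < 2√m`, the indicator is `1` and the tilting density is at least its value at
  -- `u`; elsewhere the quadratic factor is nonpositive.
  have key : Real.exp (-(u * (Real.log x + Real.log sg))) *
      binomialMean q n (fun s => 1 - (4 * m)⁻¹ * ((s : ℝ) + -m) ^ 2) ≤
      binomialMean q n (fun s => (p / q * ((1 - q) / (1 - p))) ^ s * if t ≤ s then 1 else 0) := by
    rw [← binomialMean_const_mul]
    refine binomialMean_mono hq0.le (by linarith) n fun s => ?_
    rw [hth, ← Real.exp_nat_mul]
    by_cases hs : ((s : ℝ) + -m) ^ 2 < (2 * √m) ^ 2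
    · have h3 := abs_lt_of_sq_lt_sq hs (by positivity)
      rw [abs_lt] at h3
      rw [if_pos (by linarith), mul_one]
      refine (mul_le_of_le_one_right (Real.exp_nonneg _) (sub_le_self _ (by positivity))).trans ?_
      rw [Real.exp_le_exp, mul_neg, neg_le_neg_iff]
      gcongr
      linarith
    · refine le_trans (mul_nonpos_of_nonneg_of_nonpos (Real.exp_nonneg _) ?_) ?_
      · rw [mul_pow, Real.sq_sqrt hm0.le] at hs
        rw [sub_nonpos, ← div_eq_inv_mul, one_le_div (by positivity)]
        linarith
      · split_ifs <;> positivity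
  -- Chebyshev under the tilted law, whose variance `m * (1 - q)` is at most `m`.
  have h34 : 3 / 4 ≤ binomialMean q n (fun s => 1 - (4 * m)⁻¹ * ((s : ℝ) + -m) ^ 2) := by
    rw [binomialMean_one_sub_sq, ← hm, add_neg_cancel]
    have : (4 * m)⁻¹ * (m * (1 - q) + 0 ^ 2) = (1 - q) / 4 := by field_simp; ring
    rw [this]; linarith
  have hsgn : sg ^ n = Real.exp (n * Real.log sg) := by
    rw [Real.exp_nat_mul, Real.exp_log (by linarith)]
  rw [binomialTail, binomialMean_tilt hq0.ne' (by linarith) (by linarith), ← hsg, hsgn]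
  have hexp : Real.exp (-(l * entropyH (m / l) + 2 * √m * Real.log (m / l)
      + 2 * (q - p) * (m - l + 2 * √m))) ≤
      Real.exp (n * Real.log sg) * Real.exp (-(u * (Real.log x + Real.log sg))) := by
    rw [← Real.exp_add, Real.exp_le_exp, hml]
    -- The bound `log y ≥ 1 - 1/y` turns the `n log sg` term into `m - l`, which together with `-m
    -- log x` makes `-l * entropyH x`; the rest is the error term, where `1 / (1 - p) ≤ 2`.
    have h5 : (q - p) / (1 - p) ≤ Real.log sg := by
      have := Real.one_sub_inv_le_log_of_pos (x := sg) (by linarith)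
      refine le_trans (le_of_eq ?_) this
      rw [hsg]
      have : 1 - p ≠ 0 := by linarith
      have : 1 - q ≠ 0 := by linarith
      field_simp; ring
    have h6 : (n - u) * ((q - p) / (1 - p)) ≤ (n - u) * Real.log sg :=
      mul_le_mul_of_nonneg_left h5 (by linarith)
    have h7 : (n - u) * ((q - p) / (1 - p)) = (m - l) - (q - p) * (m - l + 2 * √m) / (1 - p) := by
      have : 1 - p ≠ 0 := by linarith
      rw [hu]
      field_simp
      rw [hl, hm]; ring
    have h8 : (q - p) * (m - l + 2 * √m) / (1 - p) ≤ 2 * (q - p) * (m - l + 2 * √m) := by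
      have hml' : l ≤ m := by rw [hl, hm]; gcongr
      have h9 : 0 ≤ (q - p) * (m - l + 2 * √m) := by
        have := Real.sqrt_nonneg m
        apply mul_nonneg <;> linarith
      rw [div_le_iff₀ (by linarith)]
      nlinarith
    have h10 : l * entropyH x = l - m + m * Real.log x := by
      have : l * x = m := by rw [hl, hx, hm]; field_simp
      rw [entropyH, ← this]; ring
    rw [h10, hu]
    rw [hu] at h6 h7
    nlinarith
  calc _ ≤ 3 / 4 * (Real.exp (n * Real.log sg) * Real.exp (-(u * (Real.log x + Real.log sg)))) := by
        gcongr
    _ = Real.exp (n * Real.log sg) * (Real.exp (-(u * (Real.log x + Real.log sg))) * (3 / 4)) := by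
        ring
    _ ≤ _ := by
        refine mul_le_mul_of_nonneg_left (le_trans ?_ key) (Real.exp_nonneg _)
        gcongr

/-! ### Geometry of the torus -/

/-- Identifies `torusDist` with the Euclidean product distance on `(ℝ/ℤ)^d`, which supplies the
triangle inequality and translation invariance. -/
theorem norm_coe_unitAddCircle_eq_min {t : ℝ} (ht : |t| ≤ 1) :
    ‖(t : UnitAddCircle)‖ = min |t| (1 - |t|) := by
  have h : ‖(t : UnitAddCircle)‖ = ‖((|t| : ℝ) : UnitAddCircle)‖ := by
    rcases abs_choice t with h | h
    · rw [h]
    · rw [h, AddCircle.coe_neg, norm_neg]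
  rw [h, UnitAddCircle.norm_eq, abs_sub_round_eq_min]
  rcases ht.lt_or_eq with h1 | h1
  · rw [Int.fract_eq_self.2 ⟨abs_nonneg t, h1⟩]
  · simp [h1]

/-- The canonical map from the cube onto the torus. -/
def cubeToTorus {d : ℕ} (x : Cube d) : Fin d → UnitAddCircle := fun i => ((x i : ℝ) : UnitAddCircle)

theorem torusDist_eq_norm {d : ℕ} (x y : Cube d) :
    torusDist x y = √(∑ i, ‖cubeToTorus x i - cubeToTorus y i‖ ^ 2) := by
  unfold torusDist cubeToTorus
  congr! 3 with i
  rw [← AddCircle.coe_sub, norm_coe_unitAddCircle_eq_min]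
  exact abs_sub_le_of_nonneg_of_le (x i).2.1 (x i).2.2 (y i).2.1 (y i).2.2

theorem torusDist_eq_dist {d : ℕ} (x y : Cube d) :
    torusDist x y = dist (WithLp.toLp 2 (cubeToTorus x) : PiLp 2 fun _ : Fin d => UnitAddCircle)
      (WithLp.toLp 2 (cubeToTorus y)) := by
  rw [torusDist_eq_norm, dist_eq_norm, PiLp.norm_eq_of_L2]
  rfl

theorem torusDist_triangle {d : ℕ} (x y z : Cube d) :
    torusDist x z ≤ torusDist x y + torusDist y z := by
  simp only [torusDist_eq_dist]
  exact dist_triangle _ _ _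

theorem continuous_torusDist {d : ℕ} :
    Continuous fun p : Cube d × Cube d => torusDist p.1 p.2 := by
  unfold torusDist
  fun_prop

theorem measurableSet_torusDist_le {d : ℕ} (r : ℝ) :
    MeasurableSet {p : Cube d × Cube d | torusDist p.1 p.2 ≤ r} :=
  (isClosed_le continuous_torusDist continuous_const).measurableSet

/-- The closed ball of radius `r` about `x` in the torus. -/
def torusBall {d : ℕ} (r : ℝ) (x : Cube d) : Set (Cube d) := {y | torusDist x y ≤ r}

theorem measurableSet_torusBall {d : ℕ} (x : Cube d) (r : ℝ) :
    MeasurableSet (torusBall r x) :=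
  measurable_prodMk_left (measurableSet_torusDist_le r)

theorem measurePreserving_cubeToTorus {d : ℕ} :
    MeasurePreserving (cubeToTorus : Cube d → _) volume volume := by
  refine volume_preserving_pi (f := fun _ (t : unitInterval) => ((t : ℝ) : UnitAddCircle))
    fun _ => (UnitAddCircle.measurePreserving_mk 0).comp ?_
  rw [zero_add, Measure.restrict_congr_set (Ioc_ae_eq_Icc (μ := volume))]
  exact unitInterval.measurePreserving_coe

/-- Translate the ball to the origin of the torus and lift it to the fundamental domain `(-1/2,
1/2]^d`; as `r < 1/2`, the lift is a whole Euclidean ball. -/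
theorem volume_torusBall {d : ℕ} (x : Cube d) {r : ℝ} (h0 : 0 ≤ r) (hr : r < 1 / 2) :
    volume.real (torusBall r x) =
      volume.real (Metric.ball (0 : EuclideanSpace ℝ (Fin d)) 1) * r ^ d := by
  have hm : MeasurableSet {z : Fin d → UnitAddCircle | √(∑ i, ‖z i‖ ^ 2) ≤ r} :=
    (isClosed_le (by fun_prop) continuous_const).measurableSet
  have h1 : torusBall r x = cubeToTorus ⁻¹' ((fun z => -cubeToTorus x + z) ⁻¹'
      {z : Fin d → UnitAddCircle | √(∑ i, ‖z i‖ ^ 2) ≤ r}) := by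
    ext y
    simp [torusBall, torusDist_comm x, torusDist_eq_norm, ← sub_eq_neg_add]
  have h2 : MeasurePreserving (fun z : Fin d → UnitAddCircle => -cubeToTorus x + z) volume volume :=
    measurePreserving_add_left volume _
  have h3 : MeasurePreserving (fun (t : Fin d → ℝ) i => (t i : UnitAddCircle))
      (Measure.pi fun _ => volume.restrict (Set.Ioc (-1 / 2) (-1 / 2 + 1))) volume :=
    measurePreserving_pi _ _ fun _ => UnitAddCircle.measurePreserving_mk _
  have h4 : volume (torusBall r x) =
      ENNReal.ofReal (r ^ d) * volume (Metric.ball (0 : EuclideanSpace ℝ (Fin d)) 1) := by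
    rw [h1, measurePreserving_cubeToTorus.measure_preimage (h2.measurable hm).nullMeasurableSet,
      h2.measure_preimage hm.nullMeasurableSet, ← h3.measure_preimage hm.nullMeasurableSet,
      ← Measure.restrict_pi_pi, Measure.restrict_apply (h3.measurable hm)]
    have h5 := Measure.addHaar_closedBall volume (0 : EuclideanSpace ℝ (Fin d)) h0
    rw [finrank_euclideanSpace_fin] at h5
    rw [← h5, ← (PiLp.volume_preserving_toLp (Fin d)).measure_preimage
      Metric.isClosed_closedBall.measurableSet.nullMeasurableSet]
    change volume _ = _
    congr 1
    ext t
    have h6 : (∀ i, |t i| ≤ 1 / 2) → ∀ i, ‖(t i : UnitAddCircle)‖ = |t i| := fun h i =>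
      (AddCircle.norm_coe_eq_abs_iff 1 one_ne_zero).2 (by simpa using h i)
    simp only [Set.mem_inter_iff, Set.mem_preimage, Set.mem_ofPred_eq, Set.mem_pi, Set.mem_univ,
      true_implies, Metric.mem_closedBall, dist_zero_right, EuclideanSpace.norm_eq, Real.norm_eq_abs]
    constructor
    · rintro ⟨h, h'⟩
      rwa [Finset.sum_congr rfl fun i _ => by
        rw [h6 (fun i => abs_le.2 ⟨by linarith [(h' i).1], by linarith [(h' i).2]⟩) i]] at h
    · intro h
      have h7 : ∀ i, |t i| ≤ r := fun i => by
        refine le_trans (Real.abs_le_sqrt ?_) h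
        rw [← sq_abs]
        exact Finset.single_le_sum (f := fun i => |t i| ^ 2) (fun _ _ => by positivity)
          (Finset.mem_univ i)
      refine ⟨?_, fun i => ?_⟩
      · rwa [Finset.sum_congr rfl fun i _ => by rw [h6 (fun i => (h7 i).trans hr.le) i]]
      · have := abs_le.1 (h7 i)
        constructor <;> linarith [this.1, this.2]
  rw [measureReal_def, h4, ENNReal.toReal_mul, ENNReal.toReal_ofReal (by positivity), mul_comm]
  rfl

/-! ### Counting i.i.d. points in sets -/

section Counting

variable {α : Type*}

open Classical in
/-- The number of indices in `R` whose point lies in `B`. -/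
noncomputable def countIn (R : Finset ℕ) (B : Set α) (x : ℕ → α) : ℕ := {l ∈ R | x l ∈ B}.card

theorem countIn_insert {R : Finset ℕ} {a : ℕ} (ha : a ∉ R) (B : Set α) (x : ℕ → α)
    [Decidable (x a ∈ B)] :
    countIn (insert a R) B x = if x a ∈ B then countIn R B x + 1 else countIn R B x := by
  unfold countIn
  rw [Finset.filter_insert]
  split_ifs
  · rw [Finset.card_insert_of_notMem (by simp [ha])]
  · rfl

open Classical in
theorem countIn_singleton (l : ℕ) (B : Set α) (x : ℕ → α) :
    countIn {l} B x = if x l ∈ B then 1 else 0 := by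
  rw [← insert_empty_eq, countIn_insert (by simp)]
  simp [countIn]

/-- Shows that the count depends measurably on the coordinates in `R` alone, as the independence
arguments require. -/
theorem countIn_eq_sum (R : Finset ℕ) (B : Set α) (x : ℕ → α) :
    countIn R B x = ∑ l : R, B.indicator (fun _ => 1) (x l) := by
  classical
  rw [Finset.sum_coe_sort R fun l => B.indicator (fun _ => 1) (x l)]
  rw [countIn, Finset.card_filter]
  rfl

variable [MeasurableSpace α]

theorem measurable_sum_indicator {β : Type*} [MeasurableSpace β] (R : Finset ℕ) {B : β → Set α}
    (hB : MeasurableSet {p : β × α | p.2 ∈ B p.1}) :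
    Measurable fun p : β × (R → α) => ∑ l : R, (B p.1).indicator (fun _ => 1) (p.2 l) := by
  refine Finset.measurable_sum _ fun l _ => ?_
  have h : Measurable ({p : β × α | p.2 ∈ B p.1}.indicator fun _ => 1) :=
    measurable_const.indicator hB
  exact h.comp (measurable_fst.prodMk ((measurable_pi_apply l).comp measurable_snd))

theorem exists_measurableSet_le_countIn {β : Type*} [MeasurableSpace β] (R : Finset ℕ)
    {B : β → Set α} (hB : MeasurableSet {p : β × α | p.2 ∈ B p.1}) (t : ℝ) :
    ∃ E : Set (β × (R → α)), MeasurableSet E ∧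
      ∀ b (x : ℕ → α), t ≤ countIn R (B b) x ↔ (b, R.restrict x) ∈ E := by
  refine ⟨_, measurable_sum_indicator R hB
    (MeasurableSet.of_discrete (s := {n : ℕ | t ≤ (n : ℝ)})), fun b x => ?_⟩
  rw [countIn_eq_sum]
  rfl

variable (ν : Measure α) [IsProbabilityMeasure ν]

/-- Decoupling of disjoint sets of coordinates. -/
theorem measure_infinitePi_decouple {S R : Finset ℕ} (h : Disjoint S R)
    {E : Set ((S → α) × (R → α))} (hE : MeasurableSet E) :
    Measure.infinitePi (fun _ : ℕ => ν) {x | (S.restrict x, R.restrict x) ∈ E} =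
      ∫⁻ y, Measure.infinitePi (fun _ : ℕ => ν) {x | (S.restrict y, R.restrict x) ∈ E}
        ∂Measure.infinitePi (fun _ : ℕ => ν) := by
  have hi : iIndepFun (fun (i : ℕ) (x : ℕ → α) => x i) (Measure.infinitePi fun _ : ℕ => ν) :=
    iIndepFun_infinitePi (X := fun _ y => y) fun _ => measurable_id
  have hS : Measurable (S.restrict : (ℕ → α) → _) := Finset.measurable_restrict S
  have hR : Measurable (R.restrict : (ℕ → α) → _) := Finset.measurable_restrict R
  have h2 := (indepFun_iff_map_prod_eq_prod_map_map hS.aemeasurable hR.aemeasurable).1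
    (hi.indepFun_finset S R h fun i => measurable_pi_apply i)
  have h3 : {x : ℕ → α | (S.restrict x, R.restrict x) ∈ E} =
    (fun x => (S.restrict x, R.restrict x)) ⁻¹' E := rfl
  rw [h3, ← Measure.map_apply (hS.prodMk hR) hE]
  rw [h2, Measure.prod_apply hE, lintegral_map (measurable_measure_prodMk_left hE) hS]
  refine lintegral_congr fun y => ?_
  exact Measure.map_apply hR (measurable_prodMk_left hE)

/-- `Q y x` reads the frozen coordinates in `S` from `y` and the fresh ones in `R` from `x`; below,
`S` holds the centres of balls and `R` the points counted in them. -/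
theorem measure_infinitePi_decouple_iff {S R : Finset ℕ} (h : Disjoint S R)
    {E : Set ((S → α) × (R → α))} (hE : MeasurableSet E) {Q : (ℕ → α) → (ℕ → α) → Prop}
    (hQ : ∀ y x, Q y x ↔ (S.restrict y, R.restrict x) ∈ E) :
    Measure.infinitePi (fun _ : ℕ => ν) {x | Q x x} =
      ∫⁻ y, Measure.infinitePi (fun _ : ℕ => ν) {x | Q y x}
        ∂Measure.infinitePi (fun _ : ℕ => ν) := by
  simp only [hQ]
  exact measure_infinitePi_decouple ν h hE

theorem integral_indicator_mul_infinitePi {R : Finset ℕ} {a : ℕ} (ha : a ∉ R) {A : Set α}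
    (hA : MeasurableSet A) {G : (R → α) → ℝ} (hG : Measurable G) :
    ∫ x, A.indicator 1 (x a) * G (R.restrict x) ∂Measure.infinitePi (fun _ : ℕ => ν) =
      ν.real A * ∫ x, G (R.restrict x) ∂Measure.infinitePi (fun _ : ℕ => ν) := by
  have hi : iIndepFun (fun (i : ℕ) (x : ℕ → α) => x i) (Measure.infinitePi fun _ : ℕ => ν) :=
    iIndepFun_infinitePi (X := fun _ y => y) fun _ => measurable_id
  have hA' : Measurable (A.indicator (1 : α → ℝ)) := measurable_one.indicator hA
  have h2 := (hi.indepFun_finset {a} R (by simpa using ha) fun i => measurable_pi_apply i).comp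
    (φ := fun z : ({a} : Finset ℕ) → α => A.indicator (1 : α → ℝ) (z ⟨a, by simp⟩)) (ψ := G)
    (hA'.comp (measurable_pi_apply (⟨a, by simp⟩ : ({a} : Finset ℕ)))) hG
  have h3 : ∫ x, A.indicator (1 : α → ℝ) (x a) ∂Measure.infinitePi (fun _ : ℕ => ν) = ν.real A := by
    rw [← integral_indicator_one hA]
    have h4 := measurePreserving_eval_infinitePi (fun _ : ℕ => ν) a
    have h5 := integral_map (μ := Measure.infinitePi fun _ : ℕ => ν) h4.measurable.aemeasurable
      (f := A.indicator (1 : α → ℝ)) hA'.aestronglyMeasurable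
    rw [h4.map_eq] at h5
    exact h5.symm
  rw [← h3]
  exact IndepFun.integral_fun_mul_eq_mul_integral h2
    (hA'.comp (measurable_pi_apply a)).aestronglyMeasurable
    (hG.comp (Finset.measurable_restrict R)).aestronglyMeasurable

/-- A function of the numbers of points in two sets. -/
theorem measurable_comp_countIn₂ (R : Finset ℕ) {B B' : Set α} (hB : MeasurableSet B)
    (hB' : MeasurableSet B') (F : ℕ → ℕ → ℝ) : ∃ G : (R → α) → ℝ, Measurable G ∧
      ∀ x : ℕ → α, F (countIn R B x) (countIn R B' x) = G (R.restrict x) := by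
  have h : ∀ {D : Set α}, MeasurableSet D →
      Measurable fun z : R → α => ∑ l : R, D.indicator (fun _ => 1) (z l) := fun {D} hD =>
    Finset.measurable_sum _ fun l _ => (measurable_const.indicator hD).comp (measurable_pi_apply l)
  refine ⟨fun z => F (∑ l : R, B.indicator (fun _ => 1) (z l))
    (∑ l : R, B'.indicator (fun _ => 1) (z l)), ?_, fun x => ?_⟩
  · have : Measurable fun p : ℕ × ℕ => F p.1 p.2 := measurable_of_countable _
    exact this.comp ((h hB).prodMk (h hB'))
  · simp only [countIn_eq_sum]; rfl

theorem integrable_comp_countIn₂ (R : Finset ℕ) {B B' : Set α} (hB : MeasurableSet B)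
    (hB' : MeasurableSet B') (F : ℕ → ℕ → ℝ) :
    Integrable (fun x => F (countIn R B x) (countIn R B' x)) (Measure.infinitePi fun _ : ℕ => ν) := by
  obtain ⟨G, hG, hFG⟩ := measurable_comp_countIn₂ R hB hB' F
  have hm : AEStronglyMeasurable (fun x => F (countIn R B x) (countIn R B' x))
      (Measure.infinitePi fun _ : ℕ => ν) := by
    simp only [hFG]
    exact (hG.comp (Finset.measurable_restrict R)).aestronglyMeasurable
  refine Integrable.of_bound hm
    (∑ i ∈ Finset.range (R.card + 1), ∑ j ∈ Finset.range (R.card + 1), |F i j|)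
    (Eventually.of_forall fun x => ?_)
  have hc : ∀ D : Set α, countIn R D x ∈ Finset.range (R.card + 1) := fun D =>
    Finset.mem_range_succ_iff.2 (by classical exact Finset.card_filter_le _ _)
  rw [Real.norm_eq_abs]
  exact (Finset.single_le_sum (f := fun j => |F (countIn R B x) j|) (fun _ _ => abs_nonneg _)
    (hc B')).trans (Finset.single_le_sum
      (f := fun i => ∑ j ∈ Finset.range (R.card + 1), |F i j|)
      (fun _ _ => Finset.sum_nonneg fun _ _ => abs_nonneg _) (hc B))

/-- Conditioning on whether the new point lies in `B`, in `B'` or in neither. With `B' = ∅` this is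
the recursion defining `binomialMean`. -/
theorem integral_comp_countIn₂_insert {R : Finset ℕ} {a : ℕ} (ha : a ∉ R) {B B' : Set α}
    (hB : MeasurableSet B) (hB' : MeasurableSet B') (hd : Disjoint B B') (F : ℕ → ℕ → ℝ) :
    ∫ x, F (countIn (insert a R) B x) (countIn (insert a R) B' x)
        ∂Measure.infinitePi (fun _ : ℕ => ν) =
      ν.real B * ∫ x, F (countIn R B x + 1) (countIn R B' x) ∂Measure.infinitePi (fun _ : ℕ => ν) +
      ν.real B' * ∫ x, F (countIn R B x) (countIn R B' x + 1) ∂Measure.infinitePi (fun _ : ℕ => ν) +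
      (1 - ν.real B - ν.real B') *
        ∫ x, F (countIn R B x) (countIn R B' x) ∂Measure.infinitePi (fun _ : ℕ => ν) := by
  classical
  have hU : ν.real (B ∪ B')ᶜ = 1 - ν.real B - ν.real B' := by
    rw [probReal_compl_eq_one_sub (hB.union hB'), measureReal_union hd hB']; ring
  have key : ∀ (A : Set α), MeasurableSet A → ∀ F' : ℕ → ℕ → ℝ,
      Integrable (fun x : ℕ → α => A.indicator 1 (x a) * F' (countIn R B x) (countIn R B' x))
        (Measure.infinitePi fun _ : ℕ => ν) ∧
      ∫ x, A.indicator 1 (x a) * F' (countIn R B x) (countIn R B' x)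
        ∂Measure.infinitePi (fun _ : ℕ => ν) =
      ν.real A * ∫ x, F' (countIn R B x) (countIn R B' x) ∂Measure.infinitePi (fun _ : ℕ => ν) := by
    intro A hA F'
    constructor
    · refine (integrable_comp_countIn₂ ν R hB hB' F').bdd_mul (c := 1) ?_ ?_
      · exact ((measurable_one.indicator hA).comp (measurable_pi_apply a)).aestronglyMeasurable
      · refine Eventually.of_forall fun x => ?_
        by_cases h : x a ∈ A <;> simp [h]
    · obtain ⟨G, hG, hFG⟩ := measurable_comp_countIn₂ R hB hB' F'
      simp only [hFG]
      exact integral_indicator_mul_infinitePi ν ha hA hG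
  obtain ⟨i1, e1⟩ := key B hB fun s s' => F (s + 1) s'
  obtain ⟨i2, e2⟩ := key B' hB' fun s s' => F s (s' + 1)
  obtain ⟨i3, e3⟩ := key (B ∪ B')ᶜ (hB.union hB').compl F
  rw [← e1, ← e2, ← hU, ← e3, ← integral_add i1 i2, ← integral_add (by exact i1.add i2) i3]
  refine integral_congr_ae (Eventually.of_forall fun x => ?_)
  have hx : x a ∈ B → x a ∉ B' := fun h h' => hd.le_bot ⟨h, h'⟩
  simp only [countIn_insert ha]
  by_cases h1 : x a ∈ B
  · simp [h1, hx h1]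
  · by_cases h2 : x a ∈ B' <;> simp [h1, h2]

theorem integral_comp_countIn (R : Finset ℕ) {B : Set α} (hB : MeasurableSet B) (f : ℕ → ℝ) :
    ∫ x, f (countIn R B x) ∂Measure.infinitePi (fun _ : ℕ => ν) =
      binomialMean (ν.real B) R.card f := by
  classical
  induction R using Finset.induction_on generalizing f with
  | empty => simp [countIn, binomialMean]
  | insert a R ha ih =>
    have h := integral_comp_countIn₂_insert ν ha hB MeasurableSet.empty (by simp) fun s _ => f s
    simp only [measureReal_empty, zero_mul, add_zero, sub_zero] at h
    rw [h, Finset.card_insert_of_notMem ha, binomialMean, ih, ih fun s => f (s + 1)]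

/-- The numbers of points in two disjoint sets are negatively associated. -/
theorem integral_mul_comp_countIn_le (R : Finset ℕ) {B B' : Set α} (hB : MeasurableSet B)
    (hB' : MeasurableSet B') (hd : Disjoint B B') {f g : ℕ → ℝ} (hf : Monotone f)
    (hg : Monotone g) :
    ∫ x, f (countIn R B x) * g (countIn R B' x) ∂Measure.infinitePi (fun _ : ℕ => ν) ≤
      binomialMean (ν.real B) R.card f * binomialMean (ν.real B') R.card g := by
  classical
  induction R using Finset.induction_on generalizing f g with
  | empty => simp [countIn, binomialMean]
  | insert a R ha ih =>
    rw [integral_comp_countIn₂_insert ν ha hB hB' hd fun s s' => f s * g s',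
      Finset.card_insert_of_notMem ha, binomialMean, binomialMean]
    have hf' : Monotone fun s => f (s + 1) := fun a b h => hf (by omega)
    have hg' : Monotone fun s => g (s + 1) := fun a b h => hg (by omega)
    have h1 := ih hf hg
    have h2 := ih hf' hg
    have h3 := ih hf hg'
    have h4 : 0 ≤ 1 - ν.real B - ν.real B' := by
      have := measureReal_union hd hB' (μ := ν)
      have := measureReal_le_one (μ := ν) (s := B ∪ B')
      linarith
    have hb0 : 0 ≤ ν.real B := measureReal_nonneg
    have hb0' : 0 ≤ ν.real B' := measureReal_nonneg
    have h5 : 0 ≤ binomialMean (ν.real B) R.card (fun s => f (s + 1)) -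
        binomialMean (ν.real B) R.card f :=
      sub_nonneg.2 (binomialMean_mono hb0 measureReal_le_one _ fun s => hf (by omega))
    have h6 : 0 ≤ binomialMean (ν.real B') R.card (fun s => g (s + 1)) -
        binomialMean (ν.real B') R.card g :=
      sub_nonneg.2 (binomialMean_mono hb0' measureReal_le_one _ fun s => hg (by omega))
    -- The product of the two one-set recursions exceeds the bound from the induction hypothesis by
    -- exactly this product of increments.
    have h7 := mul_nonneg (mul_nonneg hb0 hb0') (mul_nonneg h5 h6)
    have h8 := mul_le_mul_of_nonneg_left h1 h4
    have h9 := mul_le_mul_of_nonneg_left h2 hb0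
    have h10 := mul_le_mul_of_nonneg_left h3 hb0'
    refine (add_le_add (add_le_add h9 h10) h8).trans ?_
    linarith

/-- The event that at least `t` of the points with indices in `R` lie in `B`. -/
theorem measureReal_le_countIn (R : Finset ℕ) {B : Set α} (hB : MeasurableSet B) (t : ℝ) :
    (Measure.infinitePi fun _ : ℕ => ν).real {x | t ≤ countIn R B x} =
      binomialTail (ν.real B) R.card t := by
  classical
  rw [binomialTail, ← integral_comp_countIn ν R hB, ← integral_indicator_one]
  · refine integral_congr_ae (Eventually.of_forall fun x => ?_)
    simp [Set.indicator_apply]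
  · obtain ⟨G, hG, h⟩ := measurable_comp_countIn₂ R hB hB fun s _ => (s : ℝ)
    simp only [h]
    exact measurableSet_le measurable_const (hG.comp (Finset.measurable_restrict R))

theorem measureReal_le_countIn_inter_le (R : Finset ℕ) {B B' : Set α} (hB : MeasurableSet B)
    (hB' : MeasurableSet B') (hd : Disjoint B B') (t : ℝ) :
    (Measure.infinitePi fun _ : ℕ => ν).real {x | t ≤ countIn R B x ∧ t ≤ countIn R B' x} ≤
      binomialTail (ν.real B) R.card t * binomialTail (ν.real B') R.card t := by
  classical
  have hm : Monotone fun s : ℕ => if t ≤ s then (1 : ℝ) else 0 := by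
    intro a b hab
    have : (a : ℝ) ≤ b := by exact_mod_cast hab
    dsimp only
    split_ifs <;> linarith
  refine le_trans (le_of_eq ?_) (integral_mul_comp_countIn_le ν R hB hB' hd hm hm)
  rw [← integral_indicator_one]
  · refine integral_congr_ae (Eventually.of_forall fun x => ?_)
    by_cases h1 : t ≤ countIn R B x <;> by_cases h2 : t ≤ countIn R B' x <;> simp [h1, h2]
  · obtain ⟨G, hG, h⟩ := measurable_comp_countIn₂ R hB hB fun s _ => (s : ℝ)
    obtain ⟨G', hG', h'⟩ := measurable_comp_countIn₂ R hB' hB' fun s _ => (s : ℝ)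
    simp only [h, h']
    exact (measurableSet_le measurable_const (hG.comp (Finset.measurable_restrict R))).inter
      (measurableSet_le measurable_const (hG'.comp (Finset.measurable_restrict R)))

end Counting

/-- The second moment method for events of equal probability. -/
theorem second_moment {Ω ι : Type*} [MeasurableSpace Ω] (P : Measure Ω) [IsProbabilityMeasure P]
    (C : Finset ι) (A : ι → Set Ω) (hA : ∀ j ∈ C, MeasurableSet (A j)) {p δ : ℝ} (hp : 0 < p)
    (hδ : 0 ≤ δ) (hC : C.Nonempty) (h1 : ∀ j ∈ C, P.real (A j) = p)
    (h2 : ∀ j ∈ C, ∀ l ∈ C, j ≠ l → P.real (A j ∩ A l) ≤ p ^ 2 + p * δ) :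
    P.real {x | ∀ j ∈ C, x ∉ A j} ≤ 1 / (C.card * p) + δ / p := by
  classical
  have hM : (0 : ℝ) < C.card := by exact_mod_cast hC.card_pos
  -- The centred number of events that occur. If none occurs then `Z = -(C.card * p)`, so Markov's
  -- inequality for `Z ^ 2` applies.
  set Z : Ω → ℝ := fun x => ∑ j ∈ C, ((A j).indicator 1 x - p) with hZ
  have hi : ∀ j ∈ C, ∀ l ∈ C, Integrable
      (fun x => ((A j).indicator 1 x - p) * ((A l).indicator 1 x - p)) P := by
    intro j hj l hl
    have m : ∀ j ∈ C, Measurable fun x => (A j).indicator (1 : Ω → ℝ) x - p := fun j hj =>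
      (measurable_one.indicator (hA j hj)).sub_const p
    refine Integrable.of_bound ((m j hj).mul (m l hl)).aestronglyMeasurable ((1 + p) * (1 + p))
      (Eventually.of_forall fun x => ?_)
    have b : ∀ j, |(A j).indicator (1 : Ω → ℝ) x - p| ≤ 1 + p := fun j => by
      by_cases h : x ∈ A j <;> simp only [h, Set.indicator_of_mem, Set.indicator_of_notMem,
        not_false_eq_true, Pi.one_apply] <;> rw [abs_le] <;> constructor <;> linarith
    rw [norm_mul]
    exact mul_le_mul (b j) (b l) (abs_nonneg _) (by linarith)
  have hij : ∀ j ∈ C, ∀ l ∈ C,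
      ∫ x, ((A j).indicator 1 x - p) * ((A l).indicator 1 x - p) ∂P =
        P.real (A j ∩ A l) - p ^ 2 := by
    intro j hj l hl
    have e : ∀ x, ((A j).indicator 1 x - p) * ((A l).indicator (1 : Ω → ℝ) x - p) =
        (A j ∩ A l).indicator 1 x - (p * (A j).indicator 1 x + p * (A l).indicator 1 x - p ^ 2) := by
      intro x
      rw [Set.inter_indicator_one, Pi.mul_apply]
      ring
    have ii : ∀ {D : Set Ω}, MeasurableSet D → Integrable (D.indicator (1 : Ω → ℝ)) P := fun hD =>
      (integrable_const (1 : ℝ)).indicator hD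
    simp only [e]
    have i1 := (ii (hA j hj)).const_mul p
    have i2 := (ii (hA l hl)).const_mul p
    have i3 : Integrable (fun _ : Ω => p ^ 2) P := integrable_const _
    have i4 := i1.add i2
    rw [integral_sub (ii ((hA j hj).inter (hA l hl))) (by exact i4.sub i3),
      integral_indicator_one ((hA j hj).inter (hA l hl)), integral_sub (by exact i4) i3,
      integral_add i1 i2, integral_const_mul, integral_const_mul, integral_indicator_one (hA j hj),
      integral_indicator_one (hA l hl), h1 j hj, h1 l hl, integral_const]
    simp
    ring
  have hZ2 : ∫ x, Z x ^ 2 ∂P ≤ C.card * p + C.card ^ 2 * (p * δ) := by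
    have : ∀ x, Z x ^ 2 =
        ∑ j ∈ C, ∑ l ∈ C, ((A j).indicator 1 x - p) * ((A l).indicator 1 x - p) := fun x => by
      rw [sq, hZ, Finset.sum_mul_sum]
    simp only [this]
    rw [integral_finsetSum _ fun j hj => integrable_finsetSum _ fun l hl => hi j hj l hl]
    have : ∀ j ∈ C, ∫ x, ∑ l ∈ C, ((A j).indicator 1 x - p) * ((A l).indicator 1 x - p) ∂P ≤
        ∑ l ∈ C, ((if j = l then p else 0) + p * δ) := by
      intro j hj
      rw [integral_finsetSum _ fun l hl => hi j hj l hl]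
      refine Finset.sum_le_sum fun l hl => ?_
      rw [hij j hj l hl]
      split_ifs with h
      · subst h
        rw [Set.inter_self, h1 j hj]
        nlinarith [mul_nonneg hp.le hδ]
      · linarith [h2 j hj l hl h]
    refine (Finset.sum_le_sum this).trans (le_of_eq ?_)
    simp [Finset.sum_add_distrib]
    ring
  have hZi : Integrable (fun x => Z x ^ 2) P := by
    have : (fun x => Z x ^ 2) = fun x =>
        ∑ j ∈ C, ∑ l ∈ C, ((A j).indicator 1 x - p) * ((A l).indicator 1 x - p) := by
      ext x
      rw [sq, hZ, Finset.sum_mul_sum]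
    rw [this]
    exact integrable_finsetSum _ fun j hj => integrable_finsetSum _ fun l hl => hi j hj l hl
  have hm := mul_meas_ge_le_integral_of_nonneg (Eventually.of_forall fun x => sq_nonneg (Z x)) hZi
    ((C.card * p) ^ 2)
  have hsub : {x | ∀ j ∈ C, x ∉ A j} ⊆ {x | (C.card * p) ^ 2 ≤ Z x ^ 2} := by
    intro x hx
    have : Z x = -(C.card * p) := by
      simp only [hZ]
      rw [Finset.sum_congr rfl fun j hj => by rw [Set.indicator_of_notMem (hx j hj)]]
      simp
    simp [this]
  have h3 : P.real {x | ∀ j ∈ C, x ∉ A j} ≤ P.real {x | (C.card * p) ^ 2 ≤ Z x ^ 2} :=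
    measureReal_mono hsub
  have h4 : P.real {x | (C.card * p) ^ 2 ≤ Z x ^ 2} ≤
      (C.card * p + C.card ^ 2 * (p * δ)) / (C.card * p) ^ 2 := by
    rw [le_div_iff₀ (by positivity), mul_comm]
    exact hm.trans hZ2
  refine (h3.trans h4).trans (le_of_eq ?_)
  field_simp

/-! ### Degrees in the random geometric graph -/

/-- The law of the positions of the vertices. -/
noncomputable abbrev positionsLaw (d : ℕ) : Measure (ℕ → Cube d) :=
  Measure.infinitePi fun _ => (volume : Measure (Cube d))

theorem measurableSet_torusBall_comp {d : ℕ} {β : Type*} [MeasurableSpace β] (r : ℝ)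
    {f : β → Cube d} (hf : Measurable f) :
    MeasurableSet {p : β × Cube d | p.2 ∈ torusBall r (f p.1)} :=
  ((hf.comp measurable_fst).prodMk measurable_snd) (measurableSet_torusDist_le r)

theorem measurable_countIn_torusBall {d : ℕ} (R : Finset ℕ) (r : ℝ) (j : ℕ) :
    Measurable fun x : ℕ → Cube d => countIn R (torusBall r (x j)) x := by
  have h := (measurable_sum_indicator R
    (measurableSet_torusBall_comp r (measurable_id (α := Cube d)))).comp
    ((measurable_pi_apply j).prodMk (Finset.measurable_restrict (X := fun _ : ℕ => Cube d) R))
  simp only [countIn_eq_sum]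
  exact h

theorem disjoint_torusBall {d : ℕ} {r : ℝ} {x y : Cube d} (h : 2 * r < torusDist x y) :
    Disjoint (torusBall r x) (torusBall r y) := by
  rw [Set.disjoint_left]
  intro z hz hz'
  change torusDist x z ≤ r at hz
  change torusDist y z ≤ r at hz'
  have := torusDist_triangle x z y
  rw [torusDist_comm z y] at this
  linarith

/-- With the centre frozen the count is binomial, and its parameter does not depend on the centre.
-/
theorem measureReal_le_countIn_torusBall {d : ℕ} {R : Finset ℕ} {j : ℕ} (hj : j ∉ R) (t : ℝ)
    {r : ℝ} (h0 : 0 ≤ r) (hr : r < 1 / 2) :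
    (positionsLaw d).real {x | t ≤ countIn R (torusBall r (x j)) x} =
      binomialTail (volume.real (Metric.ball (0 : EuclideanSpace ℝ (Fin d)) 1) * r ^ d) R.card t := by
  obtain ⟨E, hE, hQ⟩ := exists_measurableSet_le_countIn R (B := fun y : ({j} : Finset ℕ) → Cube d =>
    torusBall r (y ⟨j, by simp⟩)) 
      (measurableSet_torusBall_comp r (f := fun y : ({j} : Finset ℕ) → Cube d => y ⟨j, by simp⟩)
        (measurable_pi_apply (⟨j, by simp⟩ : ({j} : Finset ℕ)))) t
  have h3 := measure_infinitePi_decouple_iff (volume : Measure (Cube d)) (S := {j}) (R := R)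
    (by simpa using hj) hE (Q := fun y x => t ≤ countIn R (torusBall r (y j)) x)
    fun y x => hQ (Finset.restrict {j} y) x
  have h1 : ∀ y : ℕ → Cube d, positionsLaw d {x | t ≤ countIn R (torusBall r (y j)) x} =
      ENNReal.ofReal (binomialTail
        (volume.real (Metric.ball (0 : EuclideanSpace ℝ (Fin d)) 1) * r ^ d) R.card t) := fun y => by
    rw [← volume_torusBall (y j) h0 hr]
    rw [← measureReal_le_countIn volume R (measurableSet_torusBall _ _), ofReal_measureReal]
  rw [measureReal_def, h3, lintegral_congr h1, lintegral_const, measure_univ, mul_one,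
    ENNReal.toReal_ofReal]
  rw [← volume_torusBall (fun _ => 0) h0 hr,
    ← measureReal_le_countIn volume R (measurableSet_torusBall _ _)]
  exact measureReal_nonneg

/-- The case of a single counted point and threshold `1`. -/
theorem measureReal_torusDist_le {d : ℕ} {j l : ℕ} (hjl : j ≠ l) {r : ℝ} (h0 : 0 ≤ r)
    (hr : r < 1 / 2) :
    (positionsLaw d).real {x | torusDist (x j) (x l) ≤ r} =
      volume.real (Metric.ball (0 : EuclideanSpace ℝ (Fin d)) 1) * r ^ d := by
  have h := measureReal_le_countIn_torusBall (d := d) (R := {l}) (j := j) (by simpa using hjl) 1 h0 hr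
  have e : {x : ℕ → Cube d | torusDist (x j) (x l) ≤ r} =
      {x | (1 : ℝ) ≤ countIn {l} (torusBall r (x j)) x} := by
    ext x
    by_cases h : torusDist (x j) (x l) ≤ r <;>
      simp [countIn_singleton, torusBall, h]
  rw [e, h]
  simp [binomialTail, binomialMean]

/-- Freeze both centres. If they are more than `2 * r` apart, the balls are disjoint and negative
association gives the square; otherwise one of the two events is dropped. Closeness has probability
`2 ^ d * v` because `2 * r < 1 / 2`. -/
theorem measureReal_le_countIn_torusBall_inter_le {d : ℕ} {R : Finset ℕ} {j l : ℕ} (hj : j ∉ R)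
    (hl : l ∉ R) (hjl : j ≠ l) (t : ℝ) {r v : ℝ} (h0 : 0 ≤ r) (hr : r < 1 / 4)
    (hv : v = volume.real (Metric.ball (0 : EuclideanSpace ℝ (Fin d)) 1) * r ^ d) :
    (positionsLaw d).real ({x | t ≤ countIn R (torusBall r (x j)) x} ∩
      {x | t ≤ countIn R (torusBall r (x l)) x}) ≤
      binomialTail v R.card t ^ 2 + binomialTail v R.card t * (2 ^ d * v) := by
  set S : Finset ℕ := {j, l} with hS
  have hjS : j ∈ S := by simp [hS]
  have hlS : l ∈ S := by simp [hS]
  obtain ⟨E, hE, hQ⟩ := exists_measurableSet_le_countIn R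
    (B := fun y : S → Cube d => torusBall r (y ⟨j, hjS⟩))
    (measurableSet_torusBall_comp r (f := fun y : S → Cube d => y ⟨j, hjS⟩)
      (measurable_pi_apply (⟨j, hjS⟩ : S))) t
  obtain ⟨E', hE', hQ'⟩ := exists_measurableSet_le_countIn R
    (B := fun y : S → Cube d => torusBall r (y ⟨l, hlS⟩))
    (measurableSet_torusBall_comp r (f := fun y : S → Cube d => y ⟨l, hlS⟩)
      (measurable_pi_apply (⟨l, hlS⟩ : S))) t
  set F : (ℕ → Cube d) → Set (ℕ → Cube d) := fun y =>
    {x | t ≤ countIn R (torusBall r (y j)) x ∧ t ≤ countIn R (torusBall r (y l)) x} with hF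
  have h2 : positionsLaw d ({x | t ≤ countIn R (torusBall r (x j)) x} ∩
      {x | t ≤ countIn R (torusBall r (x l)) x}) = ∫⁻ y, positionsLaw d (F y) ∂positionsLaw d :=
    measure_infinitePi_decouple_iff (volume : Measure (Cube d)) (S := S) (R := R)
      (by simp [hS, hj, hl]) (hE.inter hE') fun y x =>
        and_congr (hQ (S.restrict y) x) (hQ' (S.restrict y) x)
  set p := binomialTail v R.card t with hp
  have hvb : ∀ x : Cube d, volume.real (torusBall r x) = v := fun x => by
    rw [hv]; exact volume_torusBall x h0 (by linarith)
  have hpx : ∀ x : Cube d, (positionsLaw d).real {z | t ≤ countIn R (torusBall r x) z} = p :=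
    fun x => by
    rw [measureReal_le_countIn volume R (measurableSet_torusBall x r), hvb]
  have hp0 : 0 ≤ p := by rw [← hpx fun _ => 0]; exact measureReal_nonneg
  have hv0 : 0 ≤ v := by rw [← hvb fun _ => 0]; exact measureReal_nonneg
  set D : Set (ℕ → Cube d) := {x | torusDist (x j) (x l) ≤ 2 * r} with hD
  have hDm : MeasurableSet D := by
    have : Measurable fun x : ℕ → Cube d => (x j, x l) :=
      (measurable_pi_apply j).prodMk (measurable_pi_apply l)
    exact this (measurableSet_torusDist_le (2 * r))
  have h3 : ∀ y, positionsLaw d (F y) ≤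
      ENNReal.ofReal (p ^ 2) + D.indicator (fun _ => ENNReal.ofReal p) y := by
    intro y
    by_cases hy : y ∈ D
    · rw [Set.indicator_of_mem hy]
      refine le_trans ?_ le_add_self
      rw [← hpx (y j), ofReal_measureReal]
      exact measure_mono fun x hx => hx.1
    · rw [Set.indicator_of_notMem hy, add_zero]
      have hd := disjoint_torusBall (not_le.1 hy)
      have h4 := measureReal_le_countIn_inter_le volume R (measurableSet_torusBall (y j) r)
        (measurableSet_torusBall (y l) r) hd t
      rw [hvb, hvb, ← sq] at h4
      rw [← ofReal_measureReal]
      exact ENNReal.ofReal_le_ofReal h4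
  have hDv : positionsLaw d D = ENNReal.ofReal (2 ^ d * v) := by
    rw [← ofReal_measureReal, measureReal_torusDist_le hjl (by linarith) (by linarith), hv]
    congr 1
    ring
  have h5 : positionsLaw d ({x | t ≤ countIn R (torusBall r (x j)) x} ∩
      {x | t ≤ countIn R (torusBall r (x l)) x}) ≤ ENNReal.ofReal (p ^ 2 + p * (2 ^ d * v)) := by
    rw [h2]
    refine (lintegral_mono h3).trans (le_of_eq ?_)
    rw [lintegral_add_left measurable_const, lintegral_const, measure_univ, mul_one,
      lintegral_indicator_const hDm, hDv, ← ENNReal.ofReal_mul hp0,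
      ← ENNReal.ofReal_add (by positivity) (by positivity)]
  exact ENNReal.toReal_le_of_le_ofReal (by positivity) h5

/-- With high probability some vertex in `C` has a large degree and the vertex `i` has not. -/
theorem measureReal_degrees_bad_le {d : ℕ} {C R U : Finset ℕ} {i : ℕ} (hCR : Disjoint C R)
    (hC : C.Nonempty) (hi : i ∉ U) {r v a s t : ℝ} (h0 : 0 ≤ r) (hr : r < 1 / 4)
    (hv : v = volume.real (Metric.ball (0 : EuclideanSpace ℝ (Fin d)) 1) * r ^ d)
    (ha : 0 < a) (hs : U.card * v + a ≤ s) (hp : 0 < binomialTail v R.card t) :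
    (positionsLaw d).real ({x | ∀ j ∈ C, x ∉ {x | t ≤ countIn R (torusBall r (x j)) x}} ∪
      {x | s ≤ countIn U (torusBall r (x i)) x}) ≤
      1 / (C.card * binomialTail v R.card t) + 2 ^ d * v / binomialTail v R.card t +
        U.card * v / a ^ 2 := by
  have hv0 : 0 ≤ v := by rw [hv]; positivity
  have hv1 : v ≤ 1 := by
    rw [hv, ← volume_torusBall (fun _ => 0) h0 (by linarith)]
    exact measureReal_le_one
  have hne : ∀ {j}, j ∈ C → j ∉ R := fun hj => Finset.disjoint_left.1 hCR hj
  refine (measureReal_union_le _ _).trans (add_le_add ?_ ?_)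
  · refine second_moment _ C _ (fun j hj => ?_) hp (by positivity) hC (fun j hj => ?_)
      fun j hj l hl hjl => measureReal_le_countIn_torusBall_inter_le (hne hj) (hne hl) hjl t h0 hr hv
    · exact measurableSet_le measurable_const
        (measurable_from_top.comp (measurable_countIn_torusBall R r j))
    · rw [measureReal_le_countIn_torusBall (hne hj) t h0 (by linarith), hv]
  · rw [measureReal_le_countIn_torusBall hi s h0 (by linarith), ← hv]
    exact binomialTail_le hv0 hv1 _ ha hs

/-- The deterministic core: counting in `R` underestimates the degree of `j`, and the degree of `i`
is at most its geometric count plus `K.card`. The strict inequality in `his` rules out ties. -/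
theorem mem_vdFails {d N k : ℕ} {r s t : ℝ} {x : ℕ → Cube d} {K R : Finset ℕ} {i j : ℕ}
    (hK : K ⊆ Finset.range N) (hKk : K.card ≤ k) (hi : i ∈ K) (hj : j ∈ Finset.range N)
    (hjK : j ∉ K) (hR : R ⊆ Finset.range N) (hjR : j ∉ R) (hst : s + k ≤ t)
    (hjt : t ≤ countIn R (torusBall r (x j)) x)
    (his : countIn ((Finset.range N).erase i) (torusBall r (x i)) x < s) :
    ((N, x, K) : Outcome d) ∈ vdFails d r k := by
  classical
  rintro ⟨-, h⟩
  have hiN := Finset.mem_range.1 (hK hi)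
  have hjN := Finset.mem_range.1 hj
  have h1 := h ⟨i, hiN⟩ (by simpa [plantedSet] using hi) ⟨j, hjN⟩ (by simpa [plantedSet] using hjK)
  set G := plantedGraph r ((N, x, K) : Outcome d)
  have h2 : countIn R (torusBall r (x j)) x ≤ G.degree ⟨j, hjN⟩ := by
    rw [← SimpleGraph.card_neighborFinset_eq_degree, ← Finset.card_map Fin.valEmbedding, countIn]
    refine Finset.card_le_card fun l hl => ?_
    rw [Finset.mem_filter] at hl
    refine Finset.mem_map.2 ⟨⟨l, Finset.mem_range.1 (hR hl.1)⟩, ?_, rfl⟩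
    rw [SimpleGraph.mem_neighborFinset]
    refine Or.inl ⟨fun e => hjR ?_, hl.2⟩
    have := congrArg Fin.val e
    simp only at this
    rw [this]
    exact hl.1
  have h3 : G.degree ⟨i, hiN⟩ ≤
      countIn ((Finset.range N).erase i) (torusBall r (x i)) x + K.card := by
    rw [← SimpleGraph.card_neighborFinset_eq_degree, ← Finset.card_map Fin.valEmbedding, countIn]
    refine le_trans (Finset.card_le_card fun l hl => ?_) (Finset.card_union_le _ _)
    obtain ⟨l, hl', rfl⟩ := Finset.mem_map.1 hl
    rw [SimpleGraph.mem_neighborFinset] at hl'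
    rw [Finset.mem_union, Finset.mem_filter]
    rcases hl' with ⟨hne, hl⟩ | ⟨-, -, hl⟩
    · refine Or.inl ⟨Finset.mem_erase.2 ⟨fun e => hne (Fin.ext e.symm), ?_⟩, hl⟩
      exact Finset.mem_range.2 l.2
    · exact Or.inr (by simpa [plantedSet] using hl)
  have h4 : (G.degree ⟨j, hjN⟩ : ℝ) ≤ G.degree ⟨i, hiN⟩ := by exact_mod_cast h1
  have h2' : (countIn R (torusBall r (x j)) x : ℝ) ≤ G.degree ⟨j, hjN⟩ := by exact_mod_cast h2
  have h3' : (G.degree ⟨i, hiN⟩ : ℝ) ≤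
      countIn ((Finset.range N).erase i) (torusBall r (x i)) x + K.card := by exact_mod_cast h3
  have hKk' : (K.card : ℝ) ≤ k := by exact_mod_cast hKk
  linarith

/-! ### The Poisson number of vertices -/

/-- The Poisson variance from factorial moments: `(n - r)² = n(n - 1) + (1 - 2r)n + r²`, the first
two terms being summed by an index shift. -/
theorem hasSum_poisson_sub_sq (r : ℝ) :
    HasSum (fun n : ℕ => Real.exp (-r) * r ^ n / n.factorial * ((n : ℝ) - r) ^ 2) r := by
  have h0 : HasSum (fun n : ℕ => Real.exp (-r) * r ^ n / n.factorial) 1 := by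
    have := (NormedSpace.expSeries_div_hasSum_exp r).mul_left (Real.exp (-r))
    rw [← Real.exp_eq_exp_ℝ, ← Real.exp_add, neg_add_cancel, Real.exp_zero] at this
    simpa only [mul_div_assoc] using this
  have h1 : HasSum (fun n : ℕ => Real.exp (-r) * r ^ n / n.factorial * n) r := by
    rw [← hasSum_nat_add_iff' 1]
    have := h0.mul_left r
    simp only [Finset.range_one, Finset.sum_singleton, CharP.cast_eq_zero, mul_zero, sub_zero]
    rw [mul_one] at this
    refine this.congr_fun fun n => ?_
    rw [Nat.factorial_succ]
    push_cast
    field_simp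
    ring
  have h2 : HasSum (fun n : ℕ => Real.exp (-r) * r ^ n / n.factorial * (n * (n - 1))) (r ^ 2) := by
    rw [← hasSum_nat_add_iff' 2]
    have := h0.mul_left (r ^ 2)
    simp only [Finset.sum_range_succ, Finset.range_zero, Finset.sum_empty, CharP.cast_eq_zero,
      zero_mul, mul_zero, Nat.cast_one, sub_self, add_zero, sub_zero]
    rw [mul_one] at this
    refine this.congr_fun fun n => ?_
    rw [Nat.factorial_succ, Nat.factorial_succ]
    push_cast
    field_simp
    ring
  have h3 := (h2.add (h1.mul_left (1 - 2 * r))).add (h0.mul_left (r ^ 2))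
  have h4 : r ^ 2 + (1 - 2 * r) * r + r ^ 2 * 1 = r := by ring
  rw [h4] at h3
  exact h3.congr_fun fun n => by ring

theorem poissonMeasure_deviation_le (r : NNReal) {a : ℝ} (ha : 0 < a) :
    (poissonMeasure r).real {N | a ≤ |(N : ℝ) - r|} ≤ r / a ^ 2 := by
  have hs := hasSum_poisson_sub_sq r
  have hi : Integrable (fun N : ℕ => ((N : ℝ) - r) ^ 2) (poissonMeasure r) := by
    rw [integrable_poissonMeasure_iff]
    simpa using hs.summable
  have hI : ∫ N : ℕ, ((N : ℝ) - r) ^ 2 ∂poissonMeasure r = r :=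
    (hasSum_integral_poissonMeasure hi).unique hs
  have h := mul_meas_ge_le_integral_of_nonneg
    (Eventually.of_forall fun N : ℕ => sq_nonneg ((N : ℝ) - r)) hi (a ^ 2)
  rw [hI] at h
  rw [le_div_iff₀ (by positivity), mul_comm]
  refine le_trans (mul_le_mul_of_nonneg_left (measureReal_mono fun N hN => ?_) (by positivity)) h
  change a ^ 2 ≤ ((N : ℝ) - r) ^ 2
  rw [← sq_abs ((N : ℝ) - r)]
  exact pow_le_pow_left₀ ha.le hN 2

theorem cliqueLaw_ae (k N : ℕ) :
    ∀ᵐ K ∂cliqueLaw k N, K ∈ Finset.powersetCard (min k N) (Finset.range N) := by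
  have hm : MeasurableSet
      (Finset.powersetCard (min k N) (Finset.range N) : Set (Finset ℕ)) :=
    (Finset.finite_toSet _).measurableSet
  refine (mem_ae_iff_prob_eq_one hm).2 ((PMF.toMeasure_apply_eq_one_iff _ hm).2 ?_)
  rw [PMF.support_uniformOfFinset]

/-- Reduces to a fixed number of vertices and a fixed clique. Measurability of `vdFails` is avoided:
its complement is covered by a measurable set `D`, and subadditivity suffices. -/
theorem plantedLaw_vdFails_ge {d n k : ℕ} {r : ℝ} (I : Set ℕ) {η₁ η₂ : ℝ} (h2 : 0 ≤ η₂)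
    (hI : (poissonMeasure (n : NNReal)).real Iᶜ ≤ η₁)
    (h : ∀ N ∈ I, ∀ K ∈ Finset.powersetCard (min k N) (Finset.range N),
      ∃ B, MeasurableSet B ∧ (positionsLaw d).real B ≤ η₂ ∧
        ∀ x ∉ B, ((N, x, K) : Outcome d) ∈ vdFails d r k) :
    1 - (η₁ + η₂) ≤ (plantedLaw d n k).real (vdFails d r k) := by
  -- For irrelevant pairs `N`, `K` the whole space serves as `B`, so that `B` can be chosen for all
  -- pairs at once.
  have h' : ∀ N K, ∃ B : Set (ℕ → Cube d), MeasurableSet B ∧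
      (N ∈ I → K ∈ Finset.powersetCard (min k N) (Finset.range N) →
        (positionsLaw d).real B ≤ η₂) ∧
      ∀ x ∉ B, ((N, x, K) : Outcome d) ∈ vdFails d r k := by
    intro N K
    by_cases hN : N ∈ I ∧ K ∈ Finset.powersetCard (min k N) (Finset.range N)
    · obtain ⟨B, hB, hB', hB''⟩ := h N hN.1 K hN.2
      exact ⟨B, hB, fun _ _ => hB', hB''⟩
    · exact ⟨Set.univ, MeasurableSet.univ, fun h1 h2 => absurd ⟨h1, h2⟩ hN, by simp⟩
  choose B hBm hB hBv using h'
  set D : Set (Outcome d) := {ω | ω.2.1 ∈ B ω.1 ω.2.2} with hD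
  have hDm : MeasurableSet D := by
    have : D = ⋃ N : ℕ, ⋃ K : Finset ℕ, {N} ×ˢ (B N K ×ˢ {K}) := by
      ext ⟨N, x, K⟩
      simp [hD]
    rw [this]
    exact MeasurableSet.iUnion fun N => MeasurableSet.iUnion fun K =>
      (measurableSet_singleton N).prod ((hBm N K).prod (measurableSet_singleton K))
  have hsub : (vdFails d r k)ᶜ ⊆ D := fun ⟨N, x, K⟩ hω => by
    by_contra hx
    exact hω (hBv N K x hx)
  have hκ : ∀ N ∈ I, positionsCliqueKernel d k N (Prod.mk N ⁻¹' D) ≤ ENNReal.ofReal η₂ := by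
    intro N hN
    change ((positionsLaw d).prod (cliqueLaw k N)) _ ≤ _
    rw [Measure.prod_apply_symm (measurable_prodMk_left hDm)]
    have : ∀ᵐ K ∂cliqueLaw k N, positionsLaw d ((fun x => (x, K)) ⁻¹' (Prod.mk N ⁻¹' D)) ≤
        ENNReal.ofReal η₂ := by
      filter_upwards [cliqueLaw_ae k N] with K hK
      change positionsLaw d (B N K) ≤ _
      rw [← ofReal_measureReal]
      exact ENNReal.ofReal_le_ofReal (hB N K hN hK)
    refine (lintegral_mono_ae this).trans ?_
    simp
  have hle : plantedLaw d n k D ≤ ENNReal.ofReal (η₁ + η₂) := by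
    rw [plantedLaw, Measure.compProd_apply hDm]
    have hb : ∀ N, positionsCliqueKernel d k N (Prod.mk N ⁻¹' D) ≤
        Iᶜ.indicator 1 N + ENNReal.ofReal η₂ := by
      intro N
      by_cases hN : N ∈ I
      · exact (hκ N hN).trans le_add_self
      · rw [Set.indicator_of_mem hN]
        exact prob_le_one.trans le_self_add
    refine (lintegral_mono hb).trans ?_
    rw [lintegral_add_right _ measurable_const, lintegral_indicator_one (MeasurableSet.of_discrete),
      lintegral_const, measure_univ, mul_one,
      ENNReal.ofReal_add (measureReal_nonneg.trans hI) h2]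
    gcongr
    rw [← ofReal_measureReal]
    exact ENNReal.ofReal_le_ofReal hI
  have h3 : (plantedLaw d n k).real D ≤ η₁ + η₂ :=
    ENNReal.toReal_le_of_le_ofReal (add_nonneg (measureReal_nonneg.trans hI) h2) hle
  have h4 : 1 ≤ (plantedLaw d n k).real (vdFails d r k) + (plantedLaw d n k).real D := by
    have h5 : (Set.univ : Set (Outcome d)) ⊆ vdFails d r k ∪ D := fun ω _ => by
      by_cases hω : ω ∈ vdFails d r k
      · exact Or.inl hω
      · exact Or.inr (hsub hω)
    have h6 := (measureReal_mono (μ := plantedLaw d n k) h5).trans (measureReal_union_le _ _)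
    simpa using h6
  linarith

/-! ### Failure of the vertex-degree algorithm for a fixed intensity -/

/-- The number of vertices used to count degrees, after `⌊n / μ⌋` candidates have been put aside. -/
noncomputable def restCard (L μ : ℝ) (n : ℕ) : ℕ := n - ⌈L * √n⌉₊ - ⌊n / μ⌋₊

section

variable {L μ v : ℝ} {n : ℕ}

/-- The margin `⌈L * √n⌉₊` lets the same reservoir size fit for every `N` with `|N - n| < L√n`, so
the tail probability does not depend on `N`. -/
theorem restCard_ge (hL : 0 ≤ L) (hμ : 0 < μ) :
    (n : ℝ) - (L * √n + 1) - n / μ ≤ restCard L μ n := by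
  have h1 : (⌈L * √n⌉₊ : ℝ) < L * √n + 1 := Nat.ceil_lt_add_one (by positivity)
  have h2 : (⌊n / μ⌋₊ : ℝ) ≤ n / μ := Nat.floor_le (by positivity)
  have h3 : (n : ℝ) ≤ restCard L μ n + ⌈L * √n⌉₊ + ⌊n / μ⌋₊ := by
    have : n ≤ restCard L μ n + ⌈L * √n⌉₊ + ⌊n / μ⌋₊ := by unfold restCard; omega
    exact_mod_cast this
  linarith

theorem half_le_restCard (hL : 0 ≤ L) (hμ : 8 ≤ μ) (hn : 8 * L ≤ √n) (hn8 : 8 ≤ n) :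
    (n : ℝ) / 2 ≤ restCard L μ n := by
  have h := restCard_ge (n := n) hL (by linarith : 0 < μ)
  have h1 : L * √n ≤ n / 8 := by
    have := Real.mul_self_sqrt (Nat.cast_nonneg n : (0 : ℝ) ≤ n)
    nlinarith [Real.sqrt_nonneg (n : ℝ)]
  have h2 : (n : ℝ) / μ ≤ n / 8 := by gcongr
  have h3 : (8 : ℝ) ≤ n := by exact_mod_cast hn8
  linarith

theorem sqrt_mul_le (hv0 : 0 ≤ v) (hv1 : v ≤ 1) (hμv : μ = n * v) : √n * v ≤ √μ := by
  rw [hμv, Real.sqrt_mul (Nat.cast_nonneg n)]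
  gcongr
  exact Real.le_sqrt_of_sq_le (by nlinarith)

theorem restCard_mul_le (hv0 : 0 ≤ v) (hμv : μ = n * v) : restCard L μ n * v ≤ μ := by
  rw [hμv]
  gcongr
  exact_mod_cast (by unfold restCard; omega : restCard L (n * v) n ≤ n)

/-- The margin costs at most `L√μ` expected points, rounding and the candidates at most `1` each,
and `2 ≤ L√μ`. -/
theorem le_restCard_mul (hL : 1 ≤ L) (hv0 : 0 ≤ v) (hv1 : v ≤ 1) (hμv : μ = n * v) (hμ : 8 ≤ μ) :
    μ - 2 * L * √μ ≤ restCard L μ n * v := by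
  have h := mul_le_mul_of_nonneg_right (restCard_ge (n := n) (by linarith : 0 ≤ L)
    (by linarith : 0 < μ)) hv0
  have h1 := sqrt_mul_le hv0 hv1 hμv
  have h2 : (n : ℝ) / μ * v = 1 := by
    rw [div_mul_eq_mul_div, ← hμv, div_self (by linarith)]
  have h3 : 2 ≤ √μ := Real.le_sqrt_of_sq_le (by linarith)
  nlinarith

/-- One `1 / L ^ 2` comes from the Poisson deviation `L√n`. The other comes from the clique vertex:
its mean is at most `μ + L√μ`, and Chebyshev is applied with deviation `2L√μ`. In `2 + 2 ^ d`, the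
`2` pays for rounding `n / μ` down and the `2 ^ d` for close pairs. -/
theorem plantedLaw_vdFails_ge_of_binomialTail {d k : ℕ} {r : ℝ} (h0 : 0 ≤ r) (hr : r < 1 / 4)
    (hv : v = volume.real (Metric.ball (0 : EuclideanSpace ℝ (Fin d)) 1) * r ^ d)
    (hμv : μ = n * v) (hL : 1 ≤ L) (hμ : 8 ≤ μ) (hLμ : 4 * L ≤ √μ) (hμn : 2 * μ ≤ n)
    (hn : 8 * L ≤ √n) (hk : 2 ≤ k) (hkn : (k : ℝ) ≤ n / 2)
    (hp : 0 < binomialTail v (restCard L μ n) (μ + 3 * L * √μ + k)) :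
    1 - (2 / L ^ 2 + (2 + 2 ^ d) *
      (n / μ * binomialTail v (restCard L μ n) (μ + 3 * L * √μ + k))⁻¹) ≤
      (plantedLaw d n k).real (vdFails d r k) := by
  set p := binomialTail v (restCard L μ n) (μ + 3 * L * √μ + k) with hpdef
  have hμ0 : 0 < μ := by linarith
  have hL0 : 0 < L := by linarith
  have hn0 : (0 : ℝ) < n := by linarith
  have hsn : 0 < √(n : ℝ) := Real.sqrt_pos.2 hn0
  have hsμ : 0 < √μ := Real.sqrt_pos.2 hμ0
  have hss := Real.mul_self_sqrt hn0.le
  have hssμ := Real.mul_self_sqrt hμ0.le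
  have hv0 : 0 ≤ v := by rw [hv]; positivity
  have hv1 : v ≤ 1 := by
    rw [hv, ← volume_torusBall (fun _ => 0) h0 (by linarith)]
    exact measureReal_le_one
  have hsv := sqrt_mul_le hv0 hv1 hμv
  have hLn : L * √n ≤ n / 8 := by nlinarith
  have hLsμ : L * √μ ≤ μ / 4 := by nlinarith
  have hM1 : (n : ℝ) / μ - 1 < ⌊n / μ⌋₊ := Nat.sub_one_lt_floor _
  have hM2 : (⌊n / μ⌋₊ : ℝ) ≤ n / μ := Nat.floor_le (by positivity)
  have hnμ : 2 ≤ (n : ℝ) / μ := by rwa [le_div_iff₀ hμ0]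
  have hnμ8 : (n : ℝ) / μ ≤ n / 8 := by gcongr
  have hrest : (restCard L μ n : ℝ) + ⌊n / μ⌋₊ + L * √n ≤ n := by
    have h1 : ⌈L * √n⌉₊ + ⌊n / μ⌋₊ ≤ n := by
      have h2 : (⌈L * √n⌉₊ : ℝ) < L * √n + 1 := Nat.ceil_lt_add_one (by positivity)
      have : (⌈L * √n⌉₊ : ℝ) + ⌊n / μ⌋₊ ≤ n := by linarith
      exact_mod_cast this
    have h3 : restCard L μ n + ⌊n / μ⌋₊ + ⌈L * √n⌉₊ = n := by unfold restCard; omega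
    have h4 : (restCard L μ n : ℝ) + ⌊n / μ⌋₊ + ⌈L * √n⌉₊ = n := by exact_mod_cast h3
    have := Nat.le_ceil (L * √n)
    linarith
  have hη : 2 / L ^ 2 + (2 + 2 ^ d) * (n / μ * p)⁻¹ =
      1 / L ^ 2 + ((2 + 2 ^ d) * (n / μ * p)⁻¹ + 1 / L ^ 2) := by ring
  rw [hη]
  refine plantedLaw_vdFails_ge {N : ℕ | |(N : ℝ) - n| < L * √n} (by positivity) ?_ ?_
  · have h1 := poissonMeasure_deviation_le (n : NNReal) (a := L * √n) (by positivity)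
    have h2 : ({N : ℕ | |(N : ℝ) - n| < L * √n}ᶜ) =
        {N : ℕ | L * √n ≤ |(N : ℝ) - ((n : NNReal) : ℝ)|} := by
      ext N; simp
    rw [h2]
    refine h1.trans (le_of_eq ?_)
    rw [NNReal.coe_natCast, mul_pow, Real.sq_sqrt hn0.le]
    field_simp
  intro N hN K hK
  have hN' := abs_lt.1 (show |(N : ℝ) - n| < L * √n from hN)
  rw [Finset.mem_powersetCard] at hK
  obtain ⟨hKN, hKc⟩ := hK
  have hKk : K.card ≤ k := by omega
  have hNpos : 0 < N := by
    have : (0 : ℝ) < N := by linarith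
    exact_mod_cast this
  obtain ⟨i, hi⟩ : K.Nonempty := Finset.card_pos.1 (by omega)
  -- Candidates lie outside the clique, as `mem_vdFails` requires; `k ≤ n / 2` leaves enough of
  -- them.
  obtain ⟨C, hCs, hCc⟩ : ∃ C ⊆ Finset.range N \ K, C.card = ⌊n / μ⌋₊ := by
    refine Finset.exists_subset_card_eq ?_
    rw [Finset.card_sdiff_of_subset hKN, Finset.card_range]
    have : (⌊n / μ⌋₊ : ℝ) + K.card ≤ N := by
      have : (K.card : ℝ) ≤ k := by exact_mod_cast hKk
      linarith
    have : ⌊n / μ⌋₊ + K.card ≤ N := by exact_mod_cast this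
    omega
  have hCN : C ⊆ Finset.range N := hCs.trans Finset.sdiff_subset
  obtain ⟨R, hRs, hRc⟩ : ∃ R ⊆ Finset.range N \ C, R.card = restCard L μ n := by
    refine Finset.exists_subset_card_eq ?_
    rw [Finset.card_sdiff_of_subset hCN, Finset.card_range, hCc]
    have : (restCard L μ n : ℝ) + ⌊n / μ⌋₊ ≤ N := by linarith
    have : restCard L μ n + ⌊n / μ⌋₊ ≤ N := by exact_mod_cast this
    omega
  have hCR : Disjoint C R :=
    Finset.disjoint_left.2 fun j hj hj' => (Finset.mem_sdiff.1 (hRs hj')).2 hj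
  have hM0 : (0 : ℝ) < ⌊n / μ⌋₊ := by linarith
  have hC : C.Nonempty := Finset.card_pos.1 (by rw [hCc]; exact_mod_cast hM0)
  set U := (Finset.range N).erase i with hU
  have hUc : (U.card : ℝ) * v ≤ μ + L * √μ := by
    have h1 : U.card ≤ N := by
      rw [hU]
      exact (Finset.card_erase_le).trans (by simp)
    have h2 : (U.card : ℝ) ≤ N := by exact_mod_cast h1
    calc (U.card : ℝ) * v ≤ (n + L * √n) * v := by gcongr; linarith
      _ = μ + L * (√n * v) := by rw [hμv]; ring
      _ ≤ μ + L * √μ := by gcongr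
  have hbad := measureReal_degrees_bad_le (d := d) hCR hC (Finset.notMem_erase i _ : i ∉ U) h0 hr hv
    (a := 2 * L * √μ) (s := μ + 3 * L * √μ) (t := μ + 3 * L * √μ + k) (by positivity)
    (by linarith) (by rwa [hRc])
  refine ⟨_, ?_, hbad.trans ?_, fun x hx => ?_⟩
  · have h1 : {x : ℕ → Cube d | ∀ j ∈ C, x ∉ {x : ℕ → Cube d |
        μ + 3 * L * √μ + k ≤ countIn R (torusBall r (x j)) x}} = ⋂ j ∈ C,
        {x : ℕ → Cube d | μ + 3 * L * √μ + k ≤ countIn R (torusBall r (x j)) x}ᶜ := by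
      ext x; simp
    rw [h1]
    exact (Finset.measurableSet_biInter C fun j _ => (measurableSet_le measurable_const
      (measurable_from_top.comp (measurable_countIn_torusBall R r j))).compl).union
      (measurableSet_le measurable_const
        (measurable_from_top.comp (measurable_countIn_torusBall U r i)))
  · rw [hRc, hCc, ← hpdef]
    have h1 : 1 / (⌊n / μ⌋₊ * p) ≤ 2 * (n / μ * p)⁻¹ := by
      calc 1 / (⌊n / μ⌋₊ * p) ≤ 1 / (n / μ / 2 * p) := by gcongr; linarith
        _ = 2 * (n / μ * p)⁻¹ := by field_simp
    have h2 : 2 ^ d * v / p = 2 ^ d * (n / μ * p)⁻¹ := by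
      have hv' : 0 < v := by
        rcases hv0.lt_or_eq with h | h
        · exact h
        · rw [← h, mul_zero] at hμv; linarith
      rw [hμv]
      field_simp
    have h3 : (U.card : ℝ) * v / (2 * L * √μ) ^ 2 ≤ 1 / L ^ 2 := by
      rw [div_le_div_iff₀ (by positivity) (by positivity), one_mul, mul_pow, mul_pow,
        Real.sq_sqrt hμ0.le]
      calc (U.card : ℝ) * v * L ^ 2 ≤ (4 * μ) * L ^ 2 :=
            mul_le_mul_of_nonneg_right (by linarith) (by positivity)
        _ = 2 ^ 2 * L ^ 2 * μ := by ring
    rw [h2]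
    linarith
  · simp only [Set.mem_union, not_or, Set.mem_ofPred_eq, not_forall, not_le] at hx
    obtain ⟨⟨j, hj, hjt⟩, his⟩ := hx
    have hj' := Finset.mem_sdiff.1 (hCs hj)
    exact mem_vdFails hKN hKk hi hj'.1 hj'.2 (hRs.trans Finset.sdiff_subset)
      (Finset.disjoint_left.1 hCR hj) le_rfl (not_lt.1 hjt) his

/-! ### Lower bounds for the tail -/

/-- Tilting to mean `m = aμ`. All errors are of order `√μ`: replacing `l` by `μ` costs `4aL√μ`, the
window around `m` costs `4a²√μ`, and the last term costs `6a²μ²/N`, which `hN` bounds by `6a²√μ`. -/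
theorem le_binomialTail_of_log_scale {a l t : ℝ} {N : ℕ} (hv : 0 < v) (hl : l = N * v) (hL : 1 ≤ L)
    (ha : 1 ≤ a) (hlμ : l ≤ μ) (hμl : μ - 2 * L * √μ ≤ l) (hμ : 8 ≤ μ) (hLμ : 4 * L ≤ √μ)
    (hN : μ * √μ ≤ N) (haN : 3 * a * μ ≤ N) (ht : t ≤ a * μ - 2 * a * √μ) :
    3 / 4 * Real.exp (-(μ * entropyH a + (4 * a * L + 10 * a ^ 2) * √μ)) ≤ binomialTail v N t := by
  have hμ0 : 0 < μ := by linarith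
  have ha0 : 0 < a := by linarith
  have hs := Real.mul_self_sqrt hμ0.le
  have hs0 : 0 < √μ := Real.sqrt_pos.2 hμ0
  have hlh : μ / 2 ≤ l := by nlinarith
  have hl0 : 0 < l := by linarith
  have hN0 : (0 : ℝ) < N := lt_of_lt_of_le (by positivity) hN
  set m := a * μ with hm
  have hm0 : 0 < m := by positivity
  have hμm : μ ≤ m := by nlinarith
  have hsm : √m ≤ a * √μ := by
    rw [hm, Real.sqrt_mul ha0.le]
    gcongr
    rw [Real.sqrt_le_left ha0.le]
    nlinarith
  have hsm' : √m ≤ m := by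
    rw [Real.sqrt_le_left hm0.le]
    nlinarith
  have hmN : m = N * (m / N) := by field_simp
  have key := le_binomialTail (p := v) (q := m / N) (n := N) (t := t) (l := l) (m := m) hv
    (by rw [le_div_iff₀ hN0, mul_comm, ← hl]; linarith)
    (by rw [div_le_iff₀ hN0]; linarith) hl hmN hm0 (by linarith) (by linarith)
  refine le_trans ?_ key
  gcongr 3 / 4 * Real.exp (-?_)
  have hlog1 : Real.log (m / l) = Real.log a + Real.log (μ / l) := by
    rw [hm, mul_div_assoc, Real.log_mul ha0.ne' (by positivity)]
  have hlog2 : m * Real.log (μ / l) ≤ 4 * a * L * √μ := by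
    have h1 := Real.log_le_sub_one_of_pos (x := μ / l) (by positivity)
    have h2 : μ / l - 1 ≤ 4 * L / √μ := by
      rw [div_sub_one hl0.ne', div_le_div_iff₀ hl0 hs0]
      nlinarith
    calc m * Real.log (μ / l) ≤ m * (4 * L / √μ) := by gcongr; linarith
      _ = 4 * a * L * √μ := by
        rw [hm]
        field_simp
        linarith [Real.sq_sqrt hμ0.le]
  have h1 : l * entropyH (m / l) ≤ μ * entropyH a + 4 * a * L * √μ := by
    have : l * entropyH (m / l) = l - m + (m * Real.log a + m * Real.log (μ / l)) := by
      rw [entropyH, hlog1]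
      field_simp
    rw [this, entropyH, hm]
    rw [hm] at hlog2
    nlinarith
  have h2 : 2 * √m * Real.log (m / l) ≤ 4 * a ^ 2 * √μ := by
    have h3 : Real.log (m / l) ≤ 2 * a := by
      have h4 := Real.log_le_sub_one_of_pos (x := m / l) (by positivity)
      have h5 : m / l ≤ 2 * a := by
        rw [div_le_iff₀ hl0, hm]
        nlinarith
      linarith
    calc 2 * √m * Real.log (m / l) ≤ 2 * √m * (2 * a) := by gcongr
      _ ≤ 2 * (a * √μ) * (2 * a) := by gcongr
      _ = _ := by ring
  have h3 : 2 * (m / N - v) * (m - l + 2 * √m) ≤ 6 * a ^ 2 * √μ := by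
    have h4 : 0 ≤ m - l + 2 * √m := by linarith [Real.sqrt_nonneg m]
    calc 2 * (m / N - v) * (m - l + 2 * √m) ≤ 2 * (m / N) * (3 * m) := by
          gcongr
          · linarith
          · linarith
      _ = 6 * a ^ 2 * (μ * μ / N) := by rw [hm]; ring
      _ ≤ 6 * a ^ 2 * √μ := by
          gcongr
          rw [div_le_iff₀ hN0]
          nlinarith
  linarith

/-- Near `1` the entropy is quadratic, so a shift of the mean by `O(√μ)` costs only a bounded
exponent. -/
theorem entropyH_le_sq {x : ℝ} (hx : 0 < x) : entropyH x ≤ (x - 1) ^ 2 := by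
  have := Real.log_le_sub_one_of_pos hx
  rw [entropyH]
  nlinarith

theorem le_binomialTail_of_sqrt_scale {l t : ℝ} {N : ℕ} (hv : 0 < v) (hl : l = N * v) (hL : 1 ≤ L)
    (hlμ : l ≤ μ) (hμl : μ - 2 * L * √μ ≤ l) (hμ : 8 ≤ μ) (hLμ : 10 * L ≤ √μ)
    (hN : 6 * μ ≤ N) (ht : t ≤ μ + 4 * L * √μ) :
    3 / 4 * Real.exp (-(800 * L ^ 2)) ≤ binomialTail v N t := by
  have hμ0 : 0 < μ := by linarith
  have hs := Real.mul_self_sqrt hμ0.le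
  have hs0 : 0 < √μ := Real.sqrt_pos.2 hμ0
  have hlh : μ / 2 ≤ l := by nlinarith
  have hl0 : 0 < l := by linarith
  have hN0 : (0 : ℝ) < N := by linarith
  -- Since `√m ≤ 2√μ`, the lower end `m - 2√m` of the window still exceeds `μ + 4L√μ`. The three
  -- exponents below add up to at most `(288 + 96 + 384)L² ≤ 800L²`.
  set m := μ + 10 * L * √μ with hm
  have hm2 : m ≤ 2 * μ := by nlinarith
  have hm0 : 0 < m := by positivity
  have hsm : √m ≤ 2 * √μ := by
    rw [Real.sqrt_le_left (by positivity), mul_pow, Real.sq_sqrt hμ0.le]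
    linarith
  have hLs : √μ ≤ L * √μ := by nlinarith
  have hμm : μ ≤ m := by rw [hm]; nlinarith
  have hml : m - l ≤ 12 * L * √μ := by linarith
  have hmN : m = N * (m / N) := by field_simp
  have hsm' : 2 * √m ≤ 4 * μ := by nlinarith
  have key := le_binomialTail (p := v) (q := m / N) (n := N) (t := t) (l := l) (m := m) hv
    (by rw [le_div_iff₀ hN0, mul_comm, ← hl]; linarith)
    (by rw [div_le_iff₀ hN0]; linarith) hl hmN hm0 (by linarith) (by linarith)
  refine le_trans ?_ key
  gcongr 3 / 4 * Real.exp (-?_)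
  have h1 : l * entropyH (m / l) ≤ 288 * L ^ 2 := by
    calc l * entropyH (m / l) ≤ l * (m / l - 1) ^ 2 := by
          gcongr; exact entropyH_le_sq (by positivity)
      _ = (m - l) ^ 2 / l := by field_simp
      _ ≤ (12 * L * √μ) ^ 2 / (μ / 2) := by
          gcongr
          linarith
      _ = 288 * L ^ 2 := by
          rw [mul_pow, Real.sq_sqrt hμ0.le]
          field_simp
          norm_num
  have h2 : 2 * √m * Real.log (m / l) ≤ 96 * L := by
    have h4 := Real.log_le_sub_one_of_pos (x := m / l) (by positivity)
    have h5 : m / l - 1 ≤ 24 * L / √μ := by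
      rw [div_sub_one hl0.ne', div_le_div_iff₀ hl0 hs0]
      nlinarith
    calc 2 * √m * Real.log (m / l) ≤ 2 * (2 * √μ) * (24 * L / √μ) := by
          have : 0 ≤ 24 * L / √μ := by positivity
          have h6 : 0 ≤ Real.log (m / l) := Real.log_nonneg (by rw [le_div_iff₀ hl0]; linarith)
          gcongr
          linarith
      _ = 96 * L := by field_simp; norm_num
  have h3 : 2 * (m / N - v) * (m - l + 2 * √m) ≤ 384 * L ^ 2 := by
    have h4 : m / N - v = (m - l) / N := by rw [hl]; field_simp
    rw [h4]
    have h5 : 0 ≤ m - l := by linarith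
    calc 2 * ((m - l) / N) * (m - l + 2 * √m)
        ≤ 2 * ((12 * L * √μ) / μ) * (16 * L * √μ) := by
          gcongr
          · linarith
          · linarith
      _ = 384 * L ^ 2 := by
          field_simp
          rw [Real.sq_sqrt hμ0.le]
          ring
  nlinarith

end

/-! ### Asymptotics -/

theorem strictMonoOn_entropyH : StrictMonoOn entropyH (Set.Ici 1) := by
  apply strictMonoOn_of_deriv_pos (convex_Ici 1)
  · unfold entropyH
    exact ((continuous_const.sub continuous_id).add Real.continuous_mul_log).continuousOn
  · intro x hx
    rw [interior_Ici, Set.mem_Ioi] at hx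
    have hd : HasDerivAt entropyH (0 - 1 + (Real.log x + 1)) x :=
      ((hasDerivAt_const x 1).sub (hasDerivAt_id x)).add (Real.hasDerivAt_mul_log (by linarith))
    rw [hd.deriv]
    linarith [Real.log_pos hx]

theorem tendsto_log_natCast_atTop : Tendsto (fun n : ℕ => Real.log n) atTop atTop :=
  Real.tendsto_log_atTop.comp tendsto_natCast_atTop_atTop

theorem tendsto_sqrt_atTop_of {μ : ℕ → ℝ} (h : Tendsto μ atTop atTop) :
    Tendsto (fun n => √(μ n)) atTop atTop := Real.tendsto_sqrt_atTop.comp h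

/-- Order of limits: for a target below `1`, a large `L` is fixed to make `2 / L ^ 2` small; then `n
→ ∞` removes the tail term. -/
theorem tendsto_plantedLaw_vdFails {d : ℕ} {r : ℕ → ℝ} (hr : ∀ n, 0 < r n ∧ r n < 1 / 4)
    {k : ℕ → ℕ} (hk : ∀ n, 2 ≤ k n) {v μ : ℕ → ℝ}
    (hv : ∀ n, v n = volume.real (Metric.ball (0 : EuclideanSpace ℝ (Fin d)) 1) * r n ^ d)
    (hμv : ∀ n, μ n = n * v n) (hμ : Tendsto μ atTop atTop)
    (hμn : ∀ᶠ n : ℕ in atTop, 2 * μ n ≤ n) (hkn : ∀ᶠ n : ℕ in atTop, (k n : ℝ) ≤ n / 2)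
    (htail : ∀ L : ℝ, 1 ≤ L → Tendsto (fun n : ℕ => n / μ n *
      binomialTail (v n) (restCard L (μ n) n) (μ n + 3 * L * √(μ n) + k n)) atTop atTop) :
    Tendsto (fun n => plantedLaw d n (k n) (vdFails d (r n) (k n))) atTop (𝓝 1) := by
  have key : Tendsto (fun n => (plantedLaw d n (k n)).real (vdFails d (r n) (k n))) atTop (𝓝 1) := by
    rw [tendsto_order]
    refine ⟨fun a ha => ?_, fun a ha => Eventually.of_forall fun n => measureReal_le_one.trans_lt ha⟩
    have h1 : Tendsto (fun L : ℝ => 1 - (2 / L ^ 2 + 0)) atTop (𝓝 (1 - (0 + 0))) :=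
      tendsto_const_nhds.sub ((tendsto_const_nhds.div_atTop
        (tendsto_pow_atTop two_ne_zero)).add tendsto_const_nhds)
    rw [add_zero, sub_zero] at h1
    obtain ⟨L, hLa, hL⟩ := ((h1.eventually_const_lt ha).and (eventually_ge_atTop 1)).exists
    have h2 := ((htail L hL).inv_tendsto_atTop.const_mul (2 + 2 ^ d : ℝ)).const_add (2 / L ^ 2)
      |>.const_sub 1
    rw [mul_zero] at h2
    filter_upwards [h2.eventually_const_lt hLa, hμ.eventually_ge_atTop 8,
      (tendsto_sqrt_atTop_of hμ).eventually_ge_atTop (4 * L), hμn, hkn,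
      (tendsto_sqrt_atTop_of tendsto_natCast_atTop_atTop).eventually_ge_atTop (8 * L),
      (htail L hL).eventually_gt_atTop 0] with n a1 a2 a3 a4 a5 a6 a7
    refine a1.trans_le (plantedLaw_vdFails_ge_of_binomialTail (hr n).1.le (hr n).2 (hv n) (hμv n) hL
      a2 a3 a4 a6 (hk n) a5 ?_)
    have : (0 : ℝ) < n / μ n := div_pos (by linarith) (by linarith)
    exact pos_of_mul_pos_right a7 this.le
  have h3 := (ENNReal.tendsto_ofReal key)
  simpa only [measureReal_def, ENNReal.ofReal_toReal (measure_ne_top _ _), ENNReal.ofReal_one]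
    using h3

section

variable {μ v : ℕ → ℝ} {k : ℕ → ℕ}

theorem tendsto_tail_of_sqrt_scale (hv0 : ∀ n, 0 < v n) (hv1 : ∀ n, v n ≤ 1)
    (hμv : ∀ n, μ n = n * v n) (hμ : Tendsto μ atTop atTop)
    (hμn : μ =o[atTop] fun n => (n : ℝ)) (hk : (fun n => (k n : ℝ)) =o[atTop] fun n => √(μ n))
    {L : ℝ} (hL : 1 ≤ L) :
    Tendsto (fun n : ℕ => n / μ n *
      binomialTail (v n) (restCard L (μ n) n) (μ n + 3 * L * √(μ n) + k n)) atTop atTop := by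
  have hdiv : Tendsto (fun n : ℕ => (n : ℝ) / μ n) atTop atTop := by
    have h1 : Tendsto (fun n : ℕ => μ n / n) atTop (𝓝[>] 0) := by
      refine tendsto_nhdsWithin_iff.2 ⟨hμn.tendsto_div_nhds_zero, ?_⟩
      filter_upwards [hμ.eventually_gt_atTop 0, eventually_gt_atTop 0] with n h1 h2
      have : (0 : ℝ) < n := by exact_mod_cast h2
      exact div_pos h1 this
    refine h1.inv_tendsto_nhdsGT_zero.congr fun n => ?_
    simp
  refine tendsto_atTop_mono' _ ?_ (hdiv.atTop_mul_const
    (by positivity : 0 < 3 / 4 * Real.exp (-(800 * L ^ 2))))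
  -- The constant `1 / 12` gives `6μ ≤ n / 2`, which is at most the reservoir size; `k ≤ √μ ≤ L√μ`
  -- puts the threshold below `μ + 4L√μ`.
  filter_upwards [hμ.eventually_ge_atTop 8, (tendsto_sqrt_atTop_of hμ).eventually_ge_atTop (10 * L),
    hμn.bound (by norm_num : (0 : ℝ) < 1 / 12), hk.bound one_pos, eventually_ge_atTop 8,
    (tendsto_sqrt_atTop_of tendsto_natCast_atTop_atTop).eventually_ge_atTop (8 * L)]
    with n a1 a2 a3 a4 a5 a6
  have h0 : (0 : ℝ) ≤ n := Nat.cast_nonneg n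
  rw [Real.norm_of_nonneg (by linarith), Real.norm_of_nonneg h0] at a3
  rw [Real.norm_of_nonneg (Nat.cast_nonneg _), Real.norm_of_nonneg (Real.sqrt_nonneg _)] at a4
  have hs := Real.sqrt_nonneg (μ n)
  refine mul_le_mul_of_nonneg_left (le_binomialTail_of_sqrt_scale (hv0 n) rfl hL
    (restCard_mul_le (hv0 n).le (hμv n)) (le_restCard_mul hL (hv0 n).le (hv1 n) (hμv n) a1) a1 a2
    ?_ ?_) (div_nonneg h0 (by linarith))
  · have := half_le_restCard (n := n) (by linarith : 0 ≤ L) a1 a6 a5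
    linarith
  · nlinarith

theorem tendsto_tail_of_log_scale (hv0 : ∀ n, 0 < v n) (hv1 : ∀ n, v n ≤ 1)
    (hμv : ∀ n, μ n = n * v n) {α c ε : ℝ} (hα : 0 < α) (hε : 0 < ε) (hε1 : ε < 1) (hc : 1 < c)
    (hcα : entropyH c = α⁻¹) (hμα : Tendsto (fun n => μ n / Real.log n) atTop (𝓝 α))
    (hμ : Tendsto μ atTop atTop)
    (hk : ∀ᶠ n in atTop, (k n : ℝ) ≤ (1 - ε) * (μ n * c - μ n))
    {L : ℝ} (hL : 1 ≤ L) :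
    Tendsto (fun n : ℕ => n / μ n *
      binomialTail (v n) (restCard L (μ n) n) (μ n + 3 * L * √(μ n) + k n)) atTop atTop := by
  -- Halfway between `1 + (1 - ε)(c - 1)`, which bounds `(μ + k) / μ`, and `c`: the room below
  -- absorbs the `√μ` terms, the room above yields `α * entropyH a < 1`.
  set a := 1 + (1 - ε / 2) * (c - 1) with ha
  have ha1 : 1 < a := by nlinarith
  have hac : a < c := by nlinarith
  have hH : α * entropyH a < 1 := by
    have := strictMonoOn_entropyH ha1.le hc.le hac
    rw [hcα] at this
    calc α * entropyH a < α * α⁻¹ := by gcongr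
      _ = 1 := mul_inv_cancel₀ hα.ne'
  -- The extra `2` absorbs the factor `1 / μ`, since `log μ ≤ 2√μ`.
  set D := 4 * a * L + 10 * a ^ 2 + 2 with hD
  have hlog := tendsto_log_natCast_atTop
  have hsq := tendsto_sqrt_atTop_of hμ
  have hsl : Tendsto (fun n => √(μ n) / Real.log n) atTop (𝓝 0) := by
    have h1 := hμα.mul hsq.inv_tendsto_atTop
    rw [mul_zero] at h1
    refine h1.congr' ?_
    filter_upwards [hμ.eventually_gt_atTop 0] with n hn
    have := Real.mul_self_sqrt hn.le
    have h2 : √(μ n) ≠ 0 := (Real.sqrt_pos.2 hn).ne'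
    simp only [Pi.inv_apply]
    rw [div_mul_eq_mul_div, ← div_eq_mul_inv, Real.div_sqrt]
  have hexp : Tendsto (fun n : ℕ => Real.log n - (μ n * entropyH a + D * √(μ n))) atTop atTop := by
    have h1 : Tendsto (fun n => 1 - (μ n / Real.log n * entropyH a + D * (√(μ n) / Real.log n)))
        atTop (𝓝 (1 - (α * entropyH a + D * 0))) :=
      ((hμα.mul_const _).add (hsl.const_mul D)).const_sub 1
    refine (hlog.atTop_mul_pos (by linarith) h1).congr' ?_
    filter_upwards [hlog.eventually_gt_atTop 0] with n hn
    field_simp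
  have hμn : Tendsto (fun n : ℕ => μ n * √(μ n) / n) atTop (𝓝 0) := by
    have h1 : Tendsto (fun n : ℕ => Real.log n ^ 2 / n) atTop (𝓝 0) := by
      have := (Real.isLittleO_pow_log_id_atTop (n := 2)).tendsto_div_nhds_zero
      exact this.comp tendsto_natCast_atTop_atTop
    have h2 := (hμα.mul hsl).mul h1
    rw [mul_zero] at h2
    refine h2.congr' ?_
    filter_upwards [hlog.eventually_gt_atTop 0] with n hn
    field_simp
  refine tendsto_atTop_mono' _ ?_ ((Real.tendsto_exp_atTop.comp hexp).const_mul_atTop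
    (by norm_num : (0 : ℝ) < 3 / 4))
  filter_upwards [hμ.eventually_ge_atTop 8, hsq.eventually_ge_atTop (4 * L),
    hsq.eventually_ge_atTop (3 * a), eventually_ge_atTop 8, hk,
    (tendsto_sqrt_atTop_of tendsto_natCast_atTop_atTop).eventually_ge_atTop (8 * L),
    hμn.eventually_lt_const (by norm_num : (0 : ℝ) < 1 / 2),
    hsq.eventually_ge_atTop ((3 * L + 2 * a) / (ε / 2 * (c - 1)))]
    with n a1 a2 a3 a4 a5 a6 a7 a8
  have hn0 : (0 : ℝ) < n := by
    have : 0 < n := by omega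
    exact_mod_cast this
  have hμ0 : 0 < μ n := by linarith
  have hss := Real.mul_self_sqrt hμ0.le
  have hN := half_le_restCard (n := n) (by linarith : 0 ≤ L) a1 a6 a4
  have hμN : μ n * √(μ n) ≤ restCard L (μ n) n := by
    rw [div_lt_iff₀ hn0] at a7
    linarith
  have hεc : 0 < ε / 2 * (c - 1) := by
    have : 0 < c - 1 := by linarith
    positivity
  -- After multiplication by `√μ` this reads `(3L + 2a)√μ ≤ (ε/2)(c - 1)μ`, the gap needed between
  -- the threshold and `aμ`.
  rw [div_le_iff₀ hεc] at a8
  have hb := le_binomialTail_of_log_scale (t := μ n + 3 * L * √(μ n) + k n) (hv0 n) rfl hL ha1.le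
    (restCard_mul_le (hv0 n).le (hμv n)) (le_restCard_mul hL (hv0 n).le (hv1 n) (hμv n) a1) a1 a2
    hμN (by nlinarith) (by
      have := mul_le_mul_of_nonneg_right a8 (Real.sqrt_nonneg (μ n))
      rw [ha] at this ⊢
      nlinarith)
  refine le_trans ?_ (mul_le_mul_of_nonneg_left hb (by positivity))
  have hlogμ : Real.log (μ n) ≤ 2 * √(μ n) := by
    have h1 := Real.log_le_sub_one_of_pos (Real.sqrt_pos.2 hμ0)
    rw [Real.log_sqrt hμ0.le] at h1
    linarith
  have hnμ : (n : ℝ) / μ n = Real.exp (Real.log n - Real.log (μ n)) := by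
    rw [Real.exp_sub, Real.exp_log hn0, Real.exp_log hμ0]
  rw [hnμ, mul_left_comm, ← Real.exp_add, Function.comp_apply]
  gcongr
  rw [hD]
  linarith

end

theorem theorem3 (d : ℕ) (hd : 1 ≤ d) (r : ℕ → ℝ) (hr : ∀ n, 0 < r n ∧ r n < 1 / 4)
    (k : ℕ → ℕ) (hk : ∀ n, 2 ≤ k n)
    (h : (∃ α ε : ℝ, 0 < α ∧ 0 < ε ∧ ε < 1 ∧
            Tendsto (fun n => meanDegree d n (r n) / Real.log n) atTop (𝓝 α) ∧
            ∀ᶠ n in atTop, (k n : ℝ) ≤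
              (1 - ε) * (maxDegreeScale (meanDegree d n (r n)) α - meanDegree d n (r n))) ∨
         (Tendsto (fun n => meanDegree d n (r n) / Real.log n) atTop atTop ∧
            (fun n => meanDegree d n (r n)) =o[atTop] (fun n => (n : ℝ)) ∧
            (fun n => (k n : ℝ)) =o[atTop] (fun n => √(meanDegree d n (r n))))) :
    Tendsto (fun n => plantedLaw d n (k n) (vdFails d (r n) (k n))) atTop (𝓝 1) := by
  set μ : ℕ → ℝ := fun n => meanDegree d n (r n) with hμdef
  set v : ℕ → ℝ := fun n => volume.real (Metric.ball (0 : EuclideanSpace ℝ (Fin d)) 1) * r n ^ d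
    with hvdef
  have hv0 : ∀ n, 0 < v n := fun n => mul_pos
    (ENNReal.toReal_pos (Metric.measure_ball_pos volume _ one_pos).ne' measure_ball_lt_top.ne)
    (pow_pos (hr n).1 d)
  have hv1 : ∀ n, v n ≤ 1 := fun n => by
    rw [hvdef]
    dsimp only
    rw [← volume_torusBall (fun _ => 0) (hr n).1.le (by linarith [(hr n).2])]
    exact measureReal_le_one
  have hμv : ∀ n, μ n = n * v n := fun n => mul_assoc _ _ _
  have hlog := tendsto_log_natCast_atTop
  rcases h with ⟨α, ε, hα, hε, hε1, hμα, hkα⟩ | ⟨hμl, hμn, hkμ⟩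
  · have hμ : Tendsto μ atTop atTop := by
      refine (hlog.atTop_mul_pos hα hμα).congr' ?_
      filter_upwards [hlog.eventually_gt_atTop 0] with n hn
      exact mul_div_cancel₀ _ hn.ne'
    have hμn : Tendsto (fun n : ℕ => μ n / n) atTop (𝓝 0) := by
      have h1 : Tendsto (fun n : ℕ => Real.log n / n) atTop (𝓝 0) :=
        Real.isLittleO_log_id_atTop.tendsto_div_nhds_zero.comp tendsto_natCast_atTop_atTop
      have h2 := hμα.mul h1
      rw [mul_zero] at h2
      refine h2.congr' ?_
      filter_upwards [hlog.eventually_gt_atTop 0] with n hn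
      field_simp
      rfl
    obtain ⟨hc1, hcα⟩ := entropyInv_spec (inv_nonneg.2 hα.le)
    set c := entropyInv α⁻¹ with hc
    -- Strict because `entropyH 1 = 0` while `α⁻¹ > 0`.
    have hc1' : 1 < c := by
      refine lt_of_le_of_ne hc1 fun h => ?_
      rw [← h, entropyH, Real.log_one] at hcα
      have := inv_pos.2 hα
      linarith
    refine tendsto_plantedLaw_vdFails hr hk (fun _ => rfl) hμv hμ ?_ ?_ fun L hL =>
      tendsto_tail_of_log_scale hv0 hv1 hμv hα hε hε1 hc1' hcα hμα hμ hkα hL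
    · filter_upwards [hμn.eventually_lt_const (by norm_num : (0 : ℝ) < 1 / 2),
        eventually_gt_atTop 0] with n h1 h2
      have : (0 : ℝ) < n := by exact_mod_cast h2
      rw [div_lt_iff₀ this] at h1
      linarith
    -- Here `k ≤ (c - 1)μ ≤ cμ`, and `1 / (2 * c)` is chosen to make `cμ < n / 2`.
    · filter_upwards [hkα, hμn.eventually_lt_const (by positivity : 0 < 1 / (2 * c)),
        eventually_gt_atTop 0, hμ.eventually_gt_atTop 0] with n h0 h1 h2 h3
      have : (0 : ℝ) < n := by exact_mod_cast h2
      rw [div_lt_div_iff₀ this (by positivity)] at h1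
      have h4 : (k n : ℝ) ≤ (1 - ε) * (μ n * c - μ n) := h0
      have h5 : 0 ≤ μ n * c - μ n := by nlinarith
      nlinarith
  · have hμ : Tendsto μ atTop atTop := by
      refine (hlog.atTop_mul_atTop₀ hμl).congr' ?_
      filter_upwards [hlog.eventually_gt_atTop 0] with n hn
      exact mul_div_cancel₀ _ hn.ne'
    have hμn2 : ∀ᶠ n : ℕ in atTop, 2 * μ n ≤ n := by
      filter_upwards [hμn.bound (by norm_num : (0 : ℝ) < 1 / 2), hμ.eventually_ge_atTop 0]
        with n h1 h2
      rw [Real.norm_of_nonneg h2, Real.norm_of_nonneg (Nat.cast_nonneg _)] at h1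
      linarith
    refine tendsto_plantedLaw_vdFails hr hk (fun _ => rfl) hμv hμ hμn2 ?_ fun L hL =>
      tendsto_tail_of_sqrt_scale hv0 hv1 hμv hμ hμn hkμ hL
    filter_upwards [hμn2, hkμ.bound one_pos, hμ.eventually_ge_atTop 1] with n h1 h2 h3
    rw [Real.norm_of_nonneg (Nat.cast_nonneg _), Real.norm_of_nonneg (Real.sqrt_nonneg _)] at h2
    have : √(μ n) ≤ μ n := Real.sqrt_le_left (by linarith) |>.2 (by nlinarith)
    linarith
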